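/- Let $r>0$, $\gamma>1/2$, and let $\ell$ be slowly varying at infinity, i.e. positive and measurable on some half-line $[A,\infty)$ with $\ell(at)/\ell(t)\to1$ as $t\to\infty$ for every $a>0$. Let $\lambda_n=\ell(n)n^{-\gamma}$, $n\ge1$, and assume that $(\lambda_n)_{n\ge1}$ is a non-increasing sequence of positive numbers. Let $\eta_1,\eta_2,\dots$ be i.i.d. gamma random variables with density $\frac{r^r}{\Gamma(r)}x^{r-1}e^{-rx}$, $x>0$. For $M\ge1$ let $$Y_M=\sum_{n=M}^\infty\lambda_n(\eta_n-1),\qquad \sigma_M^2=\operatorname{Var}Y_M,\qquad \widetilde Y_M=\sigma_M^{-1}Y_M,$$ and let $\kappa_{m,M}$ be the $m$-th cumulant of $\widetilde Y_M$, i.e. the $m$-th derivative at $t=0$ of $\log\mathbb E\,e^{t\widetilde Y_M}$. Then, for every $M\ge1$, the series defining $Y_M$ converges almost surely, $$\sigma_M^2=\frac1r\sum_{n=M}^\infty\lambda_n^2,\qquad \kappa_{m,M}=\frac{(m-1)!}{r^{m-1}\sigma_M^m}\sum_{n=M}^\infty\lambda_n^m\quad(m\ge2).$$ Moreover, for each $N\ge2$,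 as $M\to\infty$, $$\mathrm P[\widetilde Y_M\le x]=\Phi(x)-\phi(x)\sum_{(k_3,\dots,k_N)\in\eta(N)}\left[\prod_{m=3}^N\frac1{k_m!}\left(\frac{\kappa_{m,M}}{m!}\right)^{k_m}\right]H_{\zeta(k_3,\dots,k_N)}(x)+O\left(M^{-(N-1)/2}\right)$$ uniformly in $x\in\mathbb R$. Here $\Phi$ and $\phi$ are the standard normal distribution function and density; $H_k(x)=(-1)^ke^{x^2/2}\frac{d^k}{dx^k}e^{-x^2/2}$ are the Hermite polynomials; $\eta(N)$ is the set of all tuples of non-negative integers $(k_3,\dots,k_N)$ with $1\le k_3+2k_4+\dots+(N-2)k_N\le N-2$ (empty for $N=2$, so that the sum is then $0$); and $\zeta(k_3,\dots,k_N)=3k_3+4k_4+\dots+Nk_N-1$. -/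

import Mathlib

open MeasureTheory ProbabilityTheory Filter Topology

namespace GammaTail

/-- `ℓ` is slowly varying at infinity: it is positive and measurable on some half-line `[A, ∞)`,
and `ℓ (a t) / ℓ t → 1` as `t → ∞`, for every `a > 0`. -/
def SlowlyVarying (ℓ : ℝ → ℝ) : Prop :=
  (∃ A : ℝ, 0 < A ∧ (∀ t, A ≤ t → 0 < ℓ t) ∧ Measurable ((Set.Ici A).domRestrict ℓ)) ∧
    ∀ a : ℝ, 0 < a → Tendsto (fun t : ℝ => ℓ (a * t) / ℓ t) atTop (𝓝 1)

section RandomVariables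

variable {Ω : Type*} [MeasurableSpace Ω]

/-- The partial sum `∑_{n = M}^{K - 1} lam n (η n - 1)`. -/
noncomputable def partialTail (lam : ℕ → ℝ) (η : ℕ → Ω → ℝ) (M K : ℕ) (ω : Ω) : ℝ :=
  ∑ n ∈ Finset.Ico M K, lam n * (η n ω - 1)

/-- The tail `Y_M = ∑_{n = M}^∞ lam n (η n - 1)`, the pointwise limit of the partial sums. The
series need not converge absolutely, so this is not a `tsum`. -/
noncomputable def tail (lam : ℕ → ℝ) (η : ℕ → Ω → ℝ) (M : ℕ) (ω : Ω) : ℝ :=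
  limUnder atTop (fun K : ℕ => partialTail lam η M K ω)

/-- The standard deviation `σ_M` of `Y_M`. -/
noncomputable def tailStd (P : Measure Ω) (lam : ℕ → ℝ) (η : ℕ → Ω → ℝ) (M : ℕ) : ℝ :=
  Real.sqrt (variance (tail lam η M) P)

/-- The normalized tail `σ_M⁻¹ Y_M`. -/
noncomputable def normTail (P : Measure Ω) (lam : ℕ → ℝ) (η : ℕ → Ω → ℝ) (M : ℕ) (ω : Ω) : ℝ :=
  (tailStd P lam η M)⁻¹ * tail lam η M ω

/-- The `k`-th cumulant of `X`: the `k`-th derivative at `0` of `t ↦ log E[exp (t X)]`. -/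
noncomputable def cumulant (P : Measure Ω) (X : Ω → ℝ) (k : ℕ) : ℝ :=
  iteratedDeriv k (cgf X P) 0

end RandomVariables

/-- The weighted sum `k_3 + 2 k_4 + ⋯ + (N - 2) k_N`. -/
def weight (N : ℕ) (k : Finset.Icc 3 N → ℕ) : ℕ :=
  ∑ m : Finset.Icc 3 N, ((m : ℕ) - 2) * k m

/-- The set of all `(k_3, …, k_N)` with `1 ≤ k_3 + 2 k_4 + ⋯ + (N - 2) k_N ≤ N - 2`. These
inequalities force `k_m ≤ N - 2`, see `mem_indexSet`. -/
def indexSet (N : ℕ) : Finset (Finset.Icc 3 N → ℕ) :=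
  (Fintype.piFinset fun _ => Finset.range (N - 1)).filter
    fun k => 1 ≤ weight N k ∧ weight N k ≤ N - 2

theorem mem_indexSet (N : ℕ) (k : Finset.Icc 3 N → ℕ) :
    k ∈ indexSet N ↔ 1 ≤ weight N k ∧ weight N k ≤ N - 2 := by
  unfold indexSet
  rw [Finset.mem_filter, and_iff_right_iff_imp]
  rintro ⟨-, h⟩
  rw [Fintype.mem_piFinset]
  intro m
  have h3 : 3 ≤ (m : ℕ) ∧ (m : ℕ) ≤ N := Finset.mem_Icc.mp m.2
  have h1 : ((m : ℕ) - 2) * k m ≤ weight N k :=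
    Finset.single_le_sum (f := fun m : Finset.Icc 3 N => ((m : ℕ) - 2) * k m)
      (fun _ _ => Nat.zero_le _) (Finset.mem_univ m)
  have h2 : 1 * k m ≤ ((m : ℕ) - 2) * k m := Nat.mul_le_mul_right _ (by omega)
  rw [Finset.mem_range]
  omega

/-- `ζ(k_3, …, k_N) = 3 k_3 + 4 k_4 + ⋯ + N k_N - 1`. -/
def zeta (N : ℕ) (k : Finset.Icc 3 N → ℕ) : ℕ :=
  (∑ m : Finset.Icc 3 N, (m : ℕ) * k m) - 1

/-- The Edgeworth approximation of order `N` with cumulants `κ`, where `Polynomial.hermite` is the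
probabilists' Hermite polynomial. -/
noncomputable def edgeworth (N : ℕ) (κ : ℕ → ℝ) (x : ℝ) : ℝ :=
  cdf (gaussianReal 0 1) x - gaussianPDFReal 0 1 x *
    ∑ k ∈ indexSet N,
      (∏ m : Finset.Icc 3 N,
        1 / ((k m).factorial : ℝ) * (κ m / ((m : ℕ).factorial : ℝ)) ^ k m) *
      Polynomial.aeval x (Polynomial.hermite (zeta N k))

end GammaTail

/-!
The standardized tail is a series `∑ b j * ξ j` of independent centered gamma variables with
`∑ b j ^ 2 = r` and `|b j| ≤ r * θ`. Regular variation enters only through the fact that `θ` can be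
taken of order `M ^ (-1 / 2)`: since `lam (2 * M) / lam M` tends to a positive limit,
`M * lam M ^ 2` is at most a constant times the tail sum of squares.

The characteristic function of the series is `exp (∑ c m * (i t) ^ m)` for `θ * |t|` small, where
`c m = κ m / m!` satisfies `c 2 = 1 / 2` and `|c m| ≤ θ ^ (m - 2)`. The Edgeworth approximation has
the Fourier transform obtained by multiplying `exp (-t ^ 2 / 2)` by the terms of total weight at
most `N - 2` of `exp (∑ c m * (i t) ^ m)`, the sum now over `m ≥ 3` and `c m ^ k` having weight
`(m - 2) * k`, so the two transforms differ by `θ ^ (N - 1) * |t|` times an integrable function of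
`t`. For large `θ * |t|`, Bernoulli's inequality bounds the characteristic function by
`(1 + t ^ 2 / (2 * n)) ^ (-n)`, with any fixed `n` once `θ` is small. A smoothing inequality turns
these bounds into a uniform bound for the distribution functions.
-/

namespace GammaTail

open Complex

/-! ### The smoothing inequality -/

section Smoothing

/-- The characteristic function of the signed measure with density `w` with respect to `ν`. -/
noncomputable def weightedCharFun (ν : Measure ℝ) (w : ℝ → ℝ) (t : ℝ) : ℂ :=
  ∫ y, cexp (t * y * I) * w y ∂ν

/-- The Fourier transform of the indicator function of `(a, b]`, with the sign convention opposite
to the one of `charFun`, so that the two can be paired in Parseval's relation. -/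
noncomputable def intervalFourier (a b t : ℝ) : ℂ :=
  ∫ x in a..b, cexp (-(t * x * I))

variable {ν ν₁ ν₂ : Measure ℝ} {w w₁ w₂ B : ℝ → ℝ} {a b t : ℝ} {v : NNReal}

theorem norm_cexp_mul_mul_I (t y : ℝ) : ‖cexp (t * y * I)‖ = 1 := by
  simp [norm_exp]

theorem norm_cexp_neg_mul_mul_I (t y : ℝ) : ‖cexp (-(t * y * I))‖ = 1 := by
  simp [norm_exp]

theorem norm_cexp_neg_sq_div_two (t : ℝ) : ‖cexp (-(t ^ 2 / 2))‖ = Real.exp (-(t ^ 2 / 2)) := by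
  exact_mod_cast norm_exp_ofReal (-(t ^ (2 : ℕ) / 2))

theorem weightedCharFun_one (t : ℝ) : weightedCharFun ν 1 t = charFun ν t := by
  simp [weightedCharFun, charFun_apply_real]

theorem integrable_cexp_mul (hw : Integrable w ν) (t : ℝ) :
    Integrable (fun y : ℝ => cexp (t * y * I) * w y) ν :=
  hw.ofReal.bdd_mul (c := 1) (Continuous.aestronglyMeasurable (by fun_prop))
    (ae_of_all _ fun y => (norm_cexp_mul_mul_I t y).le)

theorem continuous_weightedCharFun (hw : Integrable w ν) : Continuous (weightedCharFun ν w) :=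
  continuous_of_dominated (bound := fun y => ‖w y‖)
    (fun t => (integrable_cexp_mul hw t).aestronglyMeasurable)
    (fun t => ae_of_all _ fun y => by rw [norm_mul, norm_cexp_mul_mul_I, one_mul, norm_real])
    hw.norm (ae_of_all _ fun y => by fun_prop)

theorem norm_weightedCharFun_le (t : ℝ) : ‖weightedCharFun ν w t‖ ≤ ∫ y, ‖w y‖ ∂ν := by
  refine (norm_integral_le_integral_norm _).trans_eq ?_
  simp [norm_cexp_mul_mul_I]

theorem weightedCharFun_add (hw₁ : Integrable w₁ ν) (hw₂ : Integrable w₂ ν) (t : ℝ) :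
    weightedCharFun ν (fun y => w₁ y + w₂ y) t =
      weightedCharFun ν w₁ t + weightedCharFun ν w₂ t := by
  simp_rw [weightedCharFun, ofReal_add, mul_add]
  exact integral_add (integrable_cexp_mul hw₁ t) (integrable_cexp_mul hw₂ t)

theorem weightedCharFun_sum_const_mul {ι : Type*} (s : Finset ι) (c : ι → ℝ) {u : ι → ℝ → ℝ}
    (hu : ∀ i ∈ s, Integrable (u i) ν) (t : ℝ) :
    weightedCharFun ν (fun y => ∑ i ∈ s, c i * u i y) t =
      ∑ i ∈ s, c i * weightedCharFun ν (u i) t := by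
  simp_rw [weightedCharFun, ofReal_sum, ofReal_mul, Finset.mul_sum, mul_left_comm _ (c _ : ℂ)]
  rw [integral_finsetSum s fun i hi => (integrable_cexp_mul (hu i hi) t).const_mul _]
  simp_rw [integral_const_mul]

theorem norm_intervalFourier_le_sub (hab : a ≤ b) (t : ℝ) : ‖intervalFourier a b t‖ ≤ b - a := by
  have h := intervalIntegral.norm_integral_le_of_norm_le_const (a := a) (b := b)
    fun x _ => (norm_cexp_neg_mul_mul_I t x).le
  rwa [one_mul, abs_of_nonneg (sub_nonneg.mpr hab)] at h

theorem norm_intervalFourier_le_div (a b : ℝ) (ht : t ≠ 0) :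
    ‖intervalFourier a b t‖ ≤ 2 / |t| := by
  have hc : -(t : ℂ) * I ≠ 0 := by simp [ht]
  have hint : intervalFourier a b t =
      (cexp (-(t * b * I)) - cexp (-(t * a * I))) / (-t * I) := by
    simp_rw [intervalFourier, mul_right_comm (t : ℂ) _ I, ← neg_mul]
    exact integral_exp_mul_complex hc
  rw [hint, norm_div, norm_mul, norm_neg, norm_I, mul_one, norm_real, Real.norm_eq_abs]
  gcongr
  refine (norm_sub_le _ _).trans_eq ?_
  rw [norm_cexp_neg_mul_mul_I, norm_cexp_neg_mul_mul_I]
  norm_num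

theorem continuous_intervalFourier (a b : ℝ) : Continuous (intervalFourier a b) :=
  intervalIntegral.continuous_parametric_intervalIntegral_of_continuous' (by fun_prop) a b

theorem integrable_cexp_neg_mul_sq_of_ne_zero (hv : v ≠ 0) :
    Integrable fun t : ℝ => cexp (-(v / 2 : ℂ) * t ^ 2) :=
  integrable_cexp_neg_mul_sq (b := (v / 2 : ℂ)) (by simpa using pos_iff_ne_zero.mpr hv)

theorem norm_cexp_neg_half_mul_sq_le_one (v : NNReal) (t : ℝ) :
    ‖cexp (-(v / 2 : ℂ) * t ^ 2)‖ ≤ 1 := by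
  have h : ‖cexp (-(v / 2 : ℂ) * t ^ 2)‖ = Real.exp (-(v / 2) * t ^ 2) := by
    exact_mod_cast norm_exp_ofReal (-(v / 2) * t ^ (2 : ℕ))
  rw [h, Real.exp_le_one_iff, neg_mul, neg_nonpos]
  positivity

theorem integral_cexp_eq_gaussianPDFReal (hv : v ≠ 0) (x y : ℝ) :
    ∫ t : ℝ, cexp (-(v / 2 : ℂ) * t ^ 2) * cexp (t * y * I) * cexp (-(t * x * I)) =
      2 * Real.pi * gaussianPDFReal y v x := by
  have hv' : 0 < (v : ℝ) := NNReal.coe_pos.mpr (pos_iff_ne_zero.mpr hv)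
  have hpow : ((Real.pi : ℂ) / (v / 2)) ^ (1 / 2 : ℂ) =
      ((2 * Real.pi * (Real.sqrt (2 * Real.pi * v))⁻¹ : ℝ) : ℂ) := by
    have hsqrt : Real.sqrt (Real.pi / (v / 2)) = 2 * Real.pi * (Real.sqrt (2 * Real.pi * v))⁻¹ := by
      rw [Real.sqrt_eq_iff_eq_sq (by positivity) (by positivity), mul_pow, inv_pow,
        Real.sq_sqrt (by positivity)]
      field_simp
    rw [← hsqrt, Real.sqrt_eq_rpow, ofReal_cpow (by positivity)]
    push_cast
    rfl
  calc _ = ∫ t : ℝ, cexp (I * (y - x) * t) * cexp (-(v / 2 : ℂ) * t ^ 2) := by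
        congr 1 with t
        rw [mul_assoc, ← Complex.exp_add, mul_comm]
        ring_nf
    _ = _ := by
        rw [fourierIntegral_gaussian (by simpa using hv'), hpow, gaussianPDFReal]
        push_cast
        rw [← mul_assoc]
        congr 2
        field_simp
        ring

theorem ofReal_gaussianReal_Ioc (hv : v ≠ 0) (hab : a ≤ b) (y : ℝ) :
    (((gaussianReal y v).real (Set.Ioc a b) : ℝ) : ℂ) = (2 * Real.pi : ℂ)⁻¹ *
      ∫ t : ℝ, cexp (-(v / 2 : ℂ) * t ^ 2) * cexp (t * y * I) * intervalFourier a b t := by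
  have hpi : (2 * Real.pi : ℂ) ≠ 0 := by simp [Real.pi_ne_zero]
  have hint : Integrable (Function.uncurry fun (t x : ℝ) =>
      cexp (-(v / 2 : ℂ) * t ^ 2) * cexp (t * y * I) * cexp (-(t * x * I)))
      (volume.prod (volume.restrict (Set.Ioc a b))) := by
    refine ((integrable_cexp_neg_mul_sq_of_ne_zero hv).mul_prod
      (integrable_const (1 : ℂ) (μ := volume.restrict (Set.Ioc a b)))).mono
      (Continuous.aestronglyMeasurable (by fun_prop)) (ae_of_all _ fun ⟨t, x⟩ => ?_)
    simp only [Function.uncurry_apply_pair, norm_mul, norm_cexp_mul_mul_I, norm_cexp_neg_mul_mul_I,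
      norm_one]
    exact (mul_one _).le
  have hswap : ∫ t : ℝ, cexp (-(v / 2 : ℂ) * t ^ 2) * cexp (t * y * I) * intervalFourier a b t =
      ∫ x in Set.Ioc a b, (2 * Real.pi * gaussianPDFReal y v x : ℂ) := by
    simp_rw [intervalFourier, intervalIntegral.integral_of_le hab, ← integral_const_mul]
    rw [integral_integral_swap hint]
    simp_rw [integral_cexp_eq_gaussianPDFReal hv]
  rw [hswap, integral_const_mul, inv_mul_cancel_left₀ hpi, integral_complex_ofReal,
    measureReal_def, gaussianReal_apply_eq_integral _ hv, ENNReal.toReal_ofReal]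
  exact integral_nonneg fun x => gaussianPDFReal_nonneg _ _ _

/-- Parseval's relation for `w • ν` convolved with a centred Gaussian law. -/
theorem ofReal_integral_gaussianReal_Ioc_mul [SFinite ν] (hv : v ≠ 0) (hab : a ≤ b)
    (hw : Integrable w ν) :
    ((∫ y, (gaussianReal y v).real (Set.Ioc a b) * w y ∂ν : ℝ) : ℂ) = (2 * Real.pi : ℂ)⁻¹ *
      ∫ t : ℝ, cexp (-(v / 2 : ℂ) * t ^ 2) * intervalFourier a b t * weightedCharFun ν w t := by
  have hint : Integrable (Function.uncurry fun (y t : ℝ) =>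
      w y * (cexp (-(v / 2 : ℂ) * t ^ 2) * cexp (t * y * I) * intervalFourier a b t))
      (ν.prod volume) := by
    have hker := continuous_intervalFourier a b
    refine (hw.norm.mul_prod
      ((integrable_cexp_neg_mul_sq_of_ne_zero hv).norm.mul_const (b - a))).mono ?_
      (ae_of_all _ fun ⟨y, t⟩ => ?_)
    · refine (continuous_ofReal.comp_aestronglyMeasurable hw.1).comp_fst.mul
        (Continuous.aestronglyMeasurable ?_)
      exact Continuous.mul (by fun_prop) (hker.comp continuous_snd)
    · simp only [Function.uncurry_apply_pair, norm_mul, norm_cexp_mul_mul_I, mul_one, norm_norm,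
        norm_real]
      gcongr
      exact (norm_intervalFourier_le_sub hab t).trans (le_abs_self _)
  calc _ = ∫ y, (2 * Real.pi : ℂ)⁻¹ * (∫ t : ℝ,
        w y * (cexp (-(v / 2 : ℂ) * t ^ 2) * cexp (t * y * I) * intervalFourier a b t)) ∂ν := by
        rw [← integral_complex_ofReal]
        congr 1 with y
        rw [ofReal_mul, ofReal_gaussianReal_Ioc hv hab, integral_const_mul]
        ring
    _ = _ := by
        rw [integral_const_mul, integral_integral_swap hint]
        simp_rw [weightedCharFun, ← integral_const_mul]
        congr! 4
        ring

theorem tendsto_gaussianReal_Ioc {y : ℝ} (hya : y ≠ a) (hyb : y ≠ b) :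
    Tendsto (fun n : ℕ => (gaussianReal y (1 / (n + 1))).real (Set.Ioc a b)) atTop
      (𝓝 ((Set.Ioc a b).indicator 1 y)) := by
  let μ : ℕ → ProbabilityMeasure ℝ := fun n => ⟨gaussianReal y (1 / (n + 1)), inferInstance⟩
  let δ : ProbabilityMeasure ℝ := ⟨Measure.dirac y, inferInstance⟩
  have hlim : Tendsto μ atTop (𝓝 δ) := by
    refine ProbabilityMeasure.tendsto_iff_tendsto_charFun.mpr fun t => ?_
    have h : Tendsto (fun n : ℕ => cexp (t * y * I - ((1 / (n + 1) : ℝ) : ℂ) * t ^ 2 / 2)) atTop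
        (𝓝 (cexp (t * y * I - ((0 : ℝ) : ℂ) * t ^ 2 / 2))) :=
      ((by fun_prop : Continuous fun s : ℝ => cexp (t * y * I - (s : ℂ) * t ^ 2 / 2)).tendsto
        0).comp tendsto_one_div_add_atTop_nhds_zero_nat
    simpa [μ, δ, charFun_gaussianReal, charFun_dirac, mul_comm] using h
  have hfrontier : (δ : Measure ℝ) (frontier (Set.Ioc a b)) = 0 := by
    have hy : y ∉ frontier (Set.Ioc a b) := fun hy => by
      rcases le_or_gt b a with hab | hab
      · simp [Set.Ioc_eq_empty_of_le hab] at hy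
      · simp [frontier_Ioc hab, hya, hyb] at hy
    simp [δ, hy]
  have h := (ENNReal.tendsto_toReal (measure_ne_top _ _)).comp
    (ProbabilityMeasure.tendsto_measure_of_null_frontier_of_tendsto' hlim hfrontier)
  convert! h using 2
  by_cases hy : y ∈ Set.Ioc a b <;> simp [δ, hy]

theorem measurable_gaussianReal_real (v : NNReal) {s : Set ℝ} (hs : MeasurableSet s) :
    Measurable fun y => (gaussianReal y v).real s := by
  have h : Measurable fun y => gaussianReal y v :=
    measurable_gaussianReal.comp measurable_prodMk_right
  exact ((Measure.measurable_coe hs).comp h).ennreal_toReal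

theorem tendsto_integral_gaussianReal_Ioc_mul (ha : ν {a} = 0) (hb : ν {b} = 0)
    (hw : Integrable w ν) :
    Tendsto (fun n : ℕ => ∫ y, (gaussianReal y (1 / (n + 1))).real (Set.Ioc a b) * w y ∂ν) atTop
      (𝓝 (∫ y in Set.Ioc a b, w y ∂ν)) := by
  have hlim : ∫ y in Set.Ioc a b, w y ∂ν = ∫ y, (Set.Ioc a b).indicator 1 y * w y ∂ν := by
    rw [← integral_indicator measurableSet_Ioc]
    congr! 2 with y
    by_cases h : y ∈ Set.Ioc a b <;> simp [h]
  rw [hlim]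
  refine tendsto_integral_of_dominated_convergence (fun y => ‖w y‖) (fun n => ?_) hw.norm
    (fun n => ae_of_all _ fun y => ?_) ?_
  · exact (measurable_gaussianReal_real _ measurableSet_Ioc).aestronglyMeasurable.mul hw.1
  · rw [norm_mul, Real.norm_of_nonneg measureReal_nonneg]
    exact mul_le_of_le_one_left (norm_nonneg _) measureReal_le_one
  · have hya : ∀ᵐ y ∂ν, y ≠ a := by simpa [ae_iff] using ha
    have hyb : ∀ᵐ y ∂ν, y ≠ b := by simpa [ae_iff] using hb
    filter_upwards [hya, hyb] with y hya hyb
    exact (tendsto_gaussianReal_Ioc hya hyb).mul_const _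

theorem integrable_gaussian_mul_weightedCharFun (hv : v ≠ 0) (hab : a ≤ b) (hw : Integrable w ν) :
    Integrable fun t : ℝ =>
      cexp (-(v / 2 : ℂ) * t ^ 2) * intervalFourier a b t * weightedCharFun ν w t :=
  ((integrable_cexp_neg_mul_sq_of_ne_zero hv).mul_bdd
    (continuous_intervalFourier a b).aestronglyMeasurable
    (ae_of_all _ (norm_intervalFourier_le_sub hab))).mul_bdd
    (continuous_weightedCharFun hw).aestronglyMeasurable (ae_of_all _ norm_weightedCharFun_le)

theorem abs_integral_gaussianReal_Ioc_mul_sub_le [SFinite ν₁] [SFinite ν₂]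
    (hw₁ : Integrable w₁ ν₁) (hw₂ : Integrable w₂ ν₂) (hB : Integrable B)
    (hdiff : ∀ t, t ≠ 0 → ‖weightedCharFun ν₁ w₁ t - weightedCharFun ν₂ w₂ t‖ ≤ B t * |t|)
    (hv : v ≠ 0) (hab : a ≤ b) :
    |∫ y, (gaussianReal y v).real (Set.Ioc a b) * w₁ y ∂ν₁ -
        ∫ y, (gaussianReal y v).real (Set.Ioc a b) * w₂ y ∂ν₂| ≤ Real.pi⁻¹ * ∫ t, B t := by
  rw [← Real.norm_eq_abs, ← norm_real, ofReal_sub, ofReal_integral_gaussianReal_Ioc_mul hv hab hw₁,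
    ofReal_integral_gaussianReal_Ioc_mul hv hab hw₂, ← mul_sub,
    ← integral_sub (integrable_gaussian_mul_weightedCharFun hv hab hw₁)
      (integrable_gaussian_mul_weightedCharFun hv hab hw₂)]
  have hpi : ‖(2 * Real.pi : ℂ)⁻¹‖ = Real.pi⁻¹ * 2⁻¹ := by simp [abs_of_pos Real.pi_pos]
  rw [norm_mul, hpi, mul_assoc]
  refine mul_le_mul_of_nonneg_left ?_ (by positivity)
  rw [inv_mul_le_iff₀ (by norm_num), ← integral_const_mul]
  refine norm_integral_le_of_norm_le (hB.const_mul 2) ?_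
  filter_upwards [Measure.ae_ne volume 0] with t ht
  rw [← mul_sub, norm_mul, norm_mul]
  calc _ ≤ 1 * (2 / |t|) * (B t * |t|) :=
        mul_le_mul (mul_le_mul (norm_cexp_neg_half_mul_sq_le_one v t)
          (norm_intervalFourier_le_div a b ht) (norm_nonneg _) zero_le_one) (hdiff t ht)
          (norm_nonneg _) (by positivity)
    _ = 2 * B t := by
        have : |t| ≠ 0 := abs_ne_zero.mpr ht
        field_simp

theorem dense_setOf_measure_singleton_eq_zero [SFinite ν₁] [SFinite ν₂] :
    Dense {y : ℝ | ν₁ {y} = 0 ∧ ν₂ {y} = 0} := by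
  have hatoms : ∀ ν : Measure ℝ, [SFinite ν] → {y : ℝ | 0 < ν {y}}.Countable := fun ν _ =>
    Measure.countable_meas_pos_of_disjoint_iUnion (fun _ => measurableSet_singleton _)
      fun i j hij => by simpa [Function.onFun] using hij
  refine (((hatoms ν₁).union (hatoms ν₂)).dense_compl ℝ).mono fun y hy => ?_
  simpa using hy

theorem tendsto_setIntegral_Iic_nhdsGT (hw : Integrable w ν) (x : ℝ) :
    Tendsto (fun b => ∫ y in Set.Iic b, w y ∂ν) (𝓝[>] x) (𝓝 (∫ y in Set.Iic x, w y ∂ν)) := by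
  simp_rw [← integral_indicator (measurableSet_Iic (α := ℝ))]
  refine tendsto_integral_filter_of_dominated_convergence (fun y => ‖w y‖)
    (Eventually.of_forall fun b => (hw.indicator measurableSet_Iic).aestronglyMeasurable)
    (Eventually.of_forall fun b => ae_of_all _ fun y => norm_indicator_le_norm_self _ _) hw.norm
    (ae_of_all _ fun y => tendsto_const_nhds.congr' ?_)
  rcases le_or_gt y x with hy | hy
  · filter_upwards [self_mem_nhdsWithin] with b hb
    rw [Set.indicator_of_mem (Set.mem_Iic.mpr hy),
      Set.indicator_of_mem (Set.mem_Iic.mpr (hy.trans (le_of_lt hb)))]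
  · filter_upwards [Ioo_mem_nhdsGT hy] with b hb
    rw [Set.indicator_of_notMem (by simpa using hy), Set.indicator_of_notMem (by simpa using hb.2)]

/-- **Smoothing inequality**. Dividing the difference of the characteristic functions by `t` makes
it integrable at the origin, where both signed measures have the same total mass. -/
theorem abs_setIntegral_Iic_sub_le [SFinite ν₁] [SFinite ν₂]
    (hw₁ : Integrable w₁ ν₁) (hw₂ : Integrable w₂ ν₂) (hB : Integrable B)
    (hdiff : ∀ t, t ≠ 0 → ‖weightedCharFun ν₁ w₁ t - weightedCharFun ν₂ w₂ t‖ ≤ B t * |t|)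
    (x : ℝ) :
    |∫ y in Set.Iic x, w₁ y ∂ν₁ - ∫ y in Set.Iic x, w₂ y ∂ν₂| ≤ Real.pi⁻¹ * ∫ t, B t := by
  have hdense : Dense {y : ℝ | ν₁ {y} = 0 ∧ ν₂ {y} = 0} := dense_setOf_measure_singleton_eq_zero
  have hIoc : ∀ a b, a ≤ b → ν₁ {a} = 0 ∧ ν₂ {a} = 0 → ν₁ {b} = 0 ∧ ν₂ {b} = 0 →
      |∫ y in a..b, w₁ y ∂ν₁ - ∫ y in a..b, w₂ y ∂ν₂| ≤ Real.pi⁻¹ * ∫ t, B t :=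
    fun a b hab ha hb => by
      simp_rw [intervalIntegral.integral_of_le hab]
      exact le_of_tendsto
        ((tendsto_integral_gaussianReal_Ioc_mul ha.1 hb.1 hw₁).sub
          (tendsto_integral_gaussianReal_Ioc_mul ha.2 hb.2 hw₂)).abs
        (Eventually.of_forall fun n => abs_integral_gaussianReal_Ioc_mul_sub_le hw₁ hw₂ hB hdiff
          (by positivity) hab)
  have hIic : ∀ b, ν₁ {b} = 0 ∧ ν₂ {b} = 0 →
      |∫ y in Set.Iic b, w₁ y ∂ν₁ - ∫ y in Set.Iic b, w₂ y ∂ν₂| ≤ Real.pi⁻¹ * ∫ t, B t := by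
    intro b hb
    refine le_of_tendsto_of_frequently
      ((intervalIntegral_tendsto_integral_Iic b hw₁.integrableOn tendsto_id).sub
        (intervalIntegral_tendsto_integral_Iic b hw₂.integrableOn tendsto_id)).abs
      (frequently_atBot.mpr fun c => ?_)
    obtain ⟨a, ha, hac⟩ := hdense.exists_lt (min b c)
    exact ⟨a, (hac.trans_le (min_le_right b c)).le,
      hIoc a b (hac.trans_le (min_le_left b c)).le ha hb⟩
  refine le_of_tendsto_of_frequently
    ((tendsto_setIntegral_Iic_nhdsGT hw₁ x).sub (tendsto_setIntegral_Iic_nhdsGT hw₂ x)).abs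
    ((nhdsGT_basis x).frequently_iff.mpr fun c hc => ?_)
  obtain ⟨b, hb, hbc⟩ := hdense.exists_between hc
  exact ⟨b, hbc, hIic b hb⟩

end Smoothing

/-! ### Hermite functions and the Edgeworth density -/

section Hermite

/-- The Hermite function: the standard Gaussian density times the `n`-th Hermite polynomial. -/
noncomputable def hermiteFun (n : ℕ) (x : ℝ) : ℝ :=
  gaussianPDFReal 0 1 x * Polynomial.aeval x (Polynomial.hermite n)

theorem hermiteFun_zero : hermiteFun 0 = gaussianPDFReal 0 1 := by
  ext x
  simp [hermiteFun]

theorem gaussianPDFReal_zero_one :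
    gaussianPDFReal 0 1 = fun x => (Real.sqrt (2 * Real.pi))⁻¹ * Real.exp (-(1 / 2) * x ^ 2) := by
  ext x
  rw [gaussianPDFReal, NNReal.coe_one, mul_one, sub_zero]
  ring_nf

theorem hasDerivAt_hermiteFun (n : ℕ) (x : ℝ) :
    HasDerivAt (hermiteFun n) (-hermiteFun (n + 1) x) x := by
  have hgauss : HasDerivAt (gaussianPDFReal 0 1) (-(x * gaussianPDFReal 0 1 x)) x := by
    rw [gaussianPDFReal_zero_one]
    refine ((((hasDerivAt_pow 2 x).const_mul (-(1 / 2) : ℝ)).exp).const_mul _).congr_deriv ?_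
    push_cast
    ring
  refine (hgauss.mul (Polynomial.hasDerivAt_aeval (Polynomial.hermite n) x)).congr_deriv ?_
  simp only [hermiteFun, Polynomial.hermite_succ, map_sub, map_mul, Polynomial.aeval_X]
  ring

theorem integrable_hermiteFun (n : ℕ) : Integrable (hermiteFun n) := by
  unfold hermiteFun
  simp_rw [gaussianPDFReal_zero_one,
    Polynomial.aeval_eq_sum_range, Finset.mul_sum]
  refine integrable_finsetSum _ fun i _ => ?_
  have hi : (-1 : ℝ) < i := neg_one_lt_zero.trans_le i.cast_nonneg
  refine ((integrable_rpow_mul_exp_neg_mul_sq one_half_pos hi).const_mul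
    ((Real.sqrt (2 * Real.pi))⁻¹ * (Polynomial.hermite n).coeff i)).congr (ae_of_all _ fun x => ?_)
  simp only [Real.rpow_natCast, zsmul_eq_mul]
  ring

theorem integral_Iic_hermiteFun_succ (n : ℕ) (x : ℝ) :
    ∫ y in Set.Iic x, hermiteFun (n + 1) y = -hermiteFun n x := by
  have hderiv : ∀ y, HasDerivAt (fun y => -hermiteFun n y) (hermiteFun (n + 1) y) y := fun y =>
    (hasDerivAt_hermiteFun n y).neg.congr_deriv (neg_neg _)
  have hint := (integrable_hermiteFun (n + 1)).integrableOn (s := Set.Iic x)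
  have h := integral_Iic_of_hasDerivAt_of_tendsto (hderiv x).continuousAt.continuousWithinAt
    (fun y _ => hderiv y) hint (tendsto_zero_of_hasDerivAt_of_integrableOn_Iic
      (fun y _ => hderiv y) hint (integrable_hermiteFun n).neg.integrableOn)
  rwa [sub_zero] at h

theorem weightedCharFun_hermiteFun_succ (n : ℕ) (t : ℝ) :
    weightedCharFun volume (hermiteFun (n + 1)) t =
      t * I * weightedCharFun volume (hermiteFun n) t := by
  have hexp : ∀ x : ℝ, HasDerivAt (fun x : ℝ => cexp (t * x * I)) (t * I * cexp (t * x * I)) x := by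
    intro x
    have h := (((hasDerivAt_id x).ofReal_comp.const_mul (t : ℂ)).mul_const I).cexp
    simpa [mul_comm] using h
  have hint := fun n => integrable_cexp_mul (integrable_hermiteFun n) t
  have hparts := integral_mul_deriv_eq_deriv_mul_of_integrable (fun x _ => hexp x)
    (fun x _ => (hasDerivAt_hermiteFun n x).ofReal_comp)
    ((hint (n + 1)).neg.congr (ae_of_all _ fun x => by simp))
    (((hint n).const_mul (t * I)).congr (ae_of_all _ fun x => by simp [mul_assoc])) (hint n)
  simpa [weightedCharFun, mul_assoc, integral_const_mul, integral_neg] using hparts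

theorem weightedCharFun_hermiteFun (n : ℕ) (t : ℝ) :
    weightedCharFun volume (hermiteFun n) t = (t * I) ^ n * cexp (-(t ^ 2 / 2)) := by
  induction n with
  | zero =>
    have h := charFun_gaussianReal (μ := 0) (v := 1) t
    rw [charFun_apply_real, integral_gaussianReal_eq_integral_smul one_ne_zero] at h
    simpa [weightedCharFun, hermiteFun_zero, mul_comm (cexp _)] using h
  | succ n ih => rw [weightedCharFun_hermiteFun_succ, ih, ← mul_assoc, ← pow_succ']

variable {N : ℕ} {κ : ℕ → ℝ}

/-- The coefficient of a Hermite function in the Edgeworth density. -/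
noncomputable def edgeworthCoeff (N : ℕ) (κ : ℕ → ℝ) (k : Finset.Icc 3 N → ℕ) : ℝ :=
  ∏ m : Finset.Icc 3 N, 1 / ((k m).factorial : ℝ) * (κ m / ((m : ℕ).factorial : ℝ)) ^ k m

/-- The density of the signed measure with distribution function `edgeworth N κ`. -/
noncomputable def edgeworthDensity (N : ℕ) (κ : ℕ → ℝ) (x : ℝ) : ℝ :=
  hermiteFun 0 x + ∑ k ∈ indexSet N, edgeworthCoeff N κ k * hermiteFun (zeta N k + 1) x

/-- The part of total weight at most `N - 2` of the power series of `exp (∑ m, y m)`, where `y m`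
is given weight `m - 2`. -/
noncomputable def edgeworthExp (N : ℕ) (y : ℕ → ℂ) : ℂ :=
  1 + ∑ k ∈ indexSet N, ∏ m : Finset.Icc 3 N, y m ^ k m / (k m).factorial

theorem integrable_sum_edgeworthCoeff_mul (N : ℕ) (κ : ℕ → ℝ) :
    Integrable fun x =>
      ∑ k ∈ indexSet N, edgeworthCoeff N κ k * hermiteFun (zeta N k + 1) x :=
  integrable_finsetSum _ fun _ _ => (integrable_hermiteFun _).const_mul _

theorem integrable_edgeworthDensity (N : ℕ) (κ : ℕ → ℝ) : Integrable (edgeworthDensity N κ) :=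
  (integrable_hermiteFun 0).add (integrable_sum_edgeworthCoeff_mul N κ)

theorem integral_Iic_edgeworthDensity (N : ℕ) (κ : ℕ → ℝ) (x : ℝ) :
    ∫ y in Set.Iic x, edgeworthDensity N κ y = edgeworth N κ x := by
  simp only [edgeworthDensity]
  rw [integral_add (integrable_hermiteFun 0).integrableOn
    (integrable_sum_edgeworthCoeff_mul N κ).integrableOn,
    integral_finsetSum _ fun _ _ => ((integrable_hermiteFun _).const_mul _).integrableOn]
  simp_rw [integral_const_mul, integral_Iic_hermiteFun_succ]
  rw [edgeworth, hermiteFun_zero, cdf_eq_real, measureReal_def,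
    gaussianReal_apply_eq_integral _ one_ne_zero, ENNReal.toReal_ofReal
      (integral_nonneg fun x => gaussianPDFReal_nonneg _ _ _), Finset.mul_sum, sub_eq_add_neg,
    ← Finset.sum_neg_distrib]
  congr 1
  refine Finset.sum_congr rfl fun k _ => ?_
  rw [edgeworthCoeff, hermiteFun]
  ring

theorem zeta_add_one {k : Finset.Icc 3 N → ℕ} (hk : k ∈ indexSet N) :
    zeta N k + 1 = ∑ m : Finset.Icc 3 N, (m : ℕ) * k m := by
  have hweight : weight N k ≤ ∑ m : Finset.Icc 3 N, (m : ℕ) * k m :=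
    Finset.sum_le_sum fun m _ => Nat.mul_le_mul_right _ (Nat.sub_le _ _)
  exact Nat.sub_add_cancel (((mem_indexSet N k).mp hk).1.trans hweight)

theorem edgeworthCoeff_mul_pow_zeta {k : Finset.Icc 3 N → ℕ} (hk : k ∈ indexSet N) (z : ℂ) :
    edgeworthCoeff N κ k * z ^ (zeta N k + 1) = ∏ m : Finset.Icc 3 N,
      ((κ m / (m : ℕ).factorial : ℝ) * z ^ (m : ℕ)) ^ k m / (k m).factorial := by
  rw [zeta_add_one hk, ← Finset.prod_pow_eq_pow_sum, edgeworthCoeff, ofReal_prod,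
    ← Finset.prod_mul_distrib]
  refine Finset.prod_congr rfl fun m _ => ?_
  push_cast
  rw [pow_mul, mul_pow]
  ring

theorem weightedCharFun_edgeworthDensity (N : ℕ) (κ : ℕ → ℝ) (t : ℝ) :
    weightedCharFun volume (edgeworthDensity N κ) t = cexp (-(t ^ 2 / 2)) *
      edgeworthExp N fun m => (κ m / m.factorial : ℝ) * (t * I) ^ m := by
  unfold edgeworthDensity
  rw [weightedCharFun_add (integrable_hermiteFun 0) (integrable_sum_edgeworthCoeff_mul N κ),
    weightedCharFun_sum_const_mul _ _ fun _ _ => integrable_hermiteFun _]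
  simp_rw [weightedCharFun_hermiteFun]
  rw [edgeworthExp, mul_add, Finset.mul_sum, pow_zero, one_mul, mul_one]
  congr 1
  refine Finset.sum_congr rfl fun k hk => ?_
  rw [← mul_assoc, edgeworthCoeff_mul_pow_zeta hk, mul_comm]

end Hermite

/-! ### Truncation of the exponential series -/

section Truncation

section Fintype

variable {ι : Type*} [Fintype ι] {w : ι → ℕ} {n : ℕ} {ρ : ℝ}

theorem norm_prod_pow_div_factorial_le {k : ι → ℕ} (hk : n ≤ ∑ i, w i * k i) (x : ι → ℂ)
    (hρ : 1 ≤ ρ) :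
    ‖∏ i, x i ^ k i / (k i).factorial‖ ≤
      ρ⁻¹ ^ n * ∏ i, (‖x i‖ * ρ ^ w i) ^ k i / (k i).factorial := by
  have : 0 < ρ := one_pos.trans_le hρ
  have hprod : ∏ i, (‖x i‖ * ρ ^ w i) ^ k i / (k i).factorial =
      ρ ^ (∑ i, w i * k i) * ∏ i, ‖x i‖ ^ k i / (k i).factorial := by
    rw [← Finset.prod_pow_eq_pow_sum, ← Finset.prod_mul_distrib]
    refine Finset.prod_congr rfl fun i _ => ?_
    rw [mul_pow, pow_mul]
    ring
  have hnorm : ‖∏ i, x i ^ k i / (k i).factorial‖ = ∏ i, ‖x i‖ ^ k i / (k i).factorial := by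
    simp [norm_prod]
  rw [hprod, hnorm, ← mul_assoc, inv_pow, inv_mul_eq_div]
  refine le_mul_of_one_le_left (Finset.prod_nonneg fun i _ => by positivity) ?_
  exact (one_le_div (by positivity)).mpr (pow_le_pow_right₀ hρ hk)

variable {S : Finset (ι → ℕ)}

theorem norm_prod_sum_range_sub_sum_le [DecidableEq ι] (hS : ∀ k ∉ S, n ≤ ∑ i, w i * k i)
    (x : ι → ℂ) (hρ : 1 ≤ ρ) {K : ℕ} (hK : S ⊆ Fintype.piFinset fun _ => Finset.range K) :
    ‖∏ i, ∑ j ∈ Finset.range K, x i ^ j / j.factorial -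
        ∑ k ∈ S, ∏ i, x i ^ k i / (k i).factorial‖ ≤
      ρ⁻¹ ^ n * Real.exp (∑ i, ‖x i‖ * ρ ^ w i) := by
  have : 0 < ρ := one_pos.trans_le hρ
  rw [Finset.prod_univ_sum, ← Finset.sum_sdiff_eq_sub hK]
  calc _ ≤ ∑ k ∈ (Fintype.piFinset fun _ => Finset.range K) \ S,
        ρ⁻¹ ^ n * ∏ i, (‖x i‖ * ρ ^ w i) ^ k i / (k i).factorial :=
        norm_sum_le_of_le _ fun k hk =>
          norm_prod_pow_div_factorial_le (hS k (Finset.mem_sdiff.mp hk).2) x hρ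
    _ ≤ ∑ k ∈ Fintype.piFinset fun _ => Finset.range K,
        ρ⁻¹ ^ n * ∏ i, (‖x i‖ * ρ ^ w i) ^ k i / (k i).factorial :=
        Finset.sum_le_sum_of_subset_of_nonneg Finset.sdiff_subset fun k _ _ =>
          mul_nonneg (by positivity) (Finset.prod_nonneg fun i _ => by positivity)
    _ = ρ⁻¹ ^ n * ∏ i, ∑ j ∈ Finset.range K, (‖x i‖ * ρ ^ w i) ^ j / j.factorial := by
        rw [← Finset.mul_sum, Finset.prod_univ_sum]
    _ ≤ ρ⁻¹ ^ n * ∏ i, Real.exp (‖x i‖ * ρ ^ w i) := by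
        gcongr with i
        exact Real.sum_le_exp_of_nonneg (by positivity) K
    _ = _ := by rw [Real.exp_sum]

theorem norm_cexp_sum_sub_sum_le (hS : ∀ k ∉ S, n ≤ ∑ i, w i * k i) (x : ι → ℂ) (hρ : 1 ≤ ρ) :
    ‖cexp (∑ i, x i) - ∑ k ∈ S, ∏ i, x i ^ k i / (k i).factorial‖ ≤
      ρ⁻¹ ^ n * Real.exp (∑ i, ‖x i‖ * ρ ^ w i) := by
  classical
  have hlim : Tendsto (fun K : ℕ => ∏ i, ∑ j ∈ Finset.range K, x i ^ j / j.factorial) atTop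
      (𝓝 (cexp (∑ i, x i))) := by
    simp_rw [Complex.exp_sum, Complex.exp_eq_exp_ℂ]
    exact tendsto_finsetProd _ fun i _ =>
      (NormedSpace.expSeries_div_hasSum_exp (x i)).tendsto_sum_nat
  have hK : ∀ᶠ K : ℕ in atTop, S ⊆ Fintype.piFinset fun _ => Finset.range K := by
    have h : ∀ᶠ K : ℕ in atTop, ∀ k ∈ S, ∀ i, k i < K :=
      (Finset.eventually_all S).2 fun k _ => eventually_all.2 fun i => eventually_gt_atTop (k i)
    filter_upwards [h] with K hK k hk
    simpa using hK k hk
  exact le_of_tendsto (hlim.sub_const _).norm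
    (hK.mono fun K hK => norm_prod_sum_range_sub_sum_le hS x hρ hK)

end Fintype

variable {N : ℕ} {y : ℕ → ℂ} {a q : ℝ}

theorem weight_eq_zero_iff {k : Finset.Icc 3 N → ℕ} : weight N k = 0 ↔ k = 0 := by
  simp only [weight, Finset.sum_eq_zero_iff, Finset.mem_univ, true_imp_iff, mul_eq_zero,
    funext_iff, Pi.zero_apply]
  refine forall_congr' fun m => or_iff_right ?_
  have := Finset.mem_Icc.mp m.2
  omega

theorem le_weight_of_notMem {k : Finset.Icc 3 N → ℕ} (hk : k ∉ insert 0 (indexSet N)) :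
    N - 1 ≤ weight N k := by
  rw [Finset.mem_insert, not_or, ← weight_eq_zero_iff, mem_indexSet] at hk
  omega

theorem norm_cexp_sum_sub_edgeworthExp_le (N : ℕ) (y : ℕ → ℂ) {ρ : ℝ} (hρ : 1 ≤ ρ) :
    ‖cexp (∑ m : Finset.Icc 3 N, y m) - edgeworthExp N y‖ ≤
      ρ⁻¹ ^ (N - 1) * Real.exp (∑ m : Finset.Icc 3 N, ‖y m‖ * ρ ^ ((m : ℕ) - 2)) := by
  have hzero : (0 : Finset.Icc 3 N → ℕ) ∉ indexSet N := by simp [mem_indexSet, weight]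
  have h := norm_cexp_sum_sub_sum_le (fun _ => le_weight_of_notMem (N := N)) (fun m => y m) hρ
  rw [Finset.sum_insert hzero] at h
  simpa [edgeworthExp] using h

theorem sum_Icc_pow_le (N : ℕ) :
    ∑ m : Finset.Icc 3 N, (1 / 16 : ℝ) ^ ((m : ℕ) - 2) ≤ 1 / 8 := by
  have hsum := (hasSum_geometric_of_lt_one (r := (1 / 16 : ℝ)) (by norm_num)
    (by norm_num)).mul_left (1 / 16)
  rw [Finset.sum_coe_sort (Finset.Icc 3 N) fun m => (1 / 16 : ℝ) ^ (m - 2),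
    ← Finset.Ico_add_one_right_eq_Icc, Finset.sum_Ico_eq_sum_range]
  calc _ = ∑ i ∈ Finset.range (N + 1 - 3), 1 / 16 * (1 / 16 : ℝ) ^ i :=
        Finset.sum_congr rfl fun i _ => by rw [show 3 + i - 2 = i + 1 by omega, pow_succ']
    _ ≤ 1 / 16 * (1 - 1 / 16)⁻¹ := sum_le_hasSum _ (fun i _ => by positivity) hsum
    _ ≤ 1 / 8 := by norm_num

/-- The choice `ρ = (16 q)⁻¹` gives the remainder the order `q ^ (N - 1)`. -/
theorem norm_cexp_sum_sub_edgeworthExp_le_of_geometric (ha : 0 ≤ a) (hq : 0 < q)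
    (hq' : q ≤ 1 / 16) (hy : ∀ m, 3 ≤ m → ‖y m‖ ≤ a * q ^ (m - 2)) :
    ‖cexp (∑ m : Finset.Icc 3 N, y m) - edgeworthExp N y‖ ≤
      (16 * q) ^ (N - 1) * Real.exp (a / 4) := by
  have hρ : 1 ≤ (16 * q)⁻¹ := (one_le_inv₀ (by positivity)).mpr (by linarith)
  have hsum : ∑ m : Finset.Icc 3 N, ‖y m‖ * (16 * q)⁻¹ ^ ((m : ℕ) - 2) ≤ a / 4 := by
    calc _ ≤ ∑ m : Finset.Icc 3 N, a * (1 / 16) ^ ((m : ℕ) - 2) := by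
          refine Finset.sum_le_sum fun m _ => ?_
          refine (mul_le_mul_of_nonneg_right (hy m (Finset.mem_Icc.mp m.2).1)
            (by positivity)).trans_eq ?_
          rw [mul_assoc, ← mul_pow]
          congr 2
          field_simp
      _ ≤ a * (1 / 8) := by
          rw [← Finset.mul_sum]
          exact mul_le_mul_of_nonneg_left (sum_Icc_pow_le N) ha
      _ ≤ a / 4 := by linarith
  refine (norm_cexp_sum_sub_edgeworthExp_le N y hρ).trans ?_
  rw [inv_inv]
  gcongr

theorem norm_tsum_nat_add_le_of_geometric (hN : 2 ≤ N) (ha : 0 ≤ a) (hq : 0 < q)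
    (hq' : q ≤ 1 / 16) (hy : ∀ m, 3 ≤ m → ‖y m‖ ≤ a * q ^ (m - 2)) :
    ‖∑' j, y (j + (N + 1))‖ ≤ 2 * a * q ^ (N - 1) := by
  have hgeom := (hasSum_geometric_of_lt_one hq.le (by linarith : q < 1)).mul_left
    (a * q ^ (N - 1))
  refine (tsum_of_norm_bounded hgeom fun j => ?_).trans ?_
  · refine (hy _ (by omega)).trans_eq ?_
    rw [mul_assoc, ← pow_add]
    congr 2
    omega
  · have h : (1 - q)⁻¹ ≤ 2 := inv_le_of_inv_le₀ two_pos (by linarith)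
    calc _ ≤ a * q ^ (N - 1) * 2 := by gcongr
      _ = _ := by ring

theorem norm_cexp_sub_cexp_le {z z' : ℂ} : ‖cexp z' - cexp z‖ ≤
    ‖z' - z‖ * Real.exp (‖z‖ + ‖z' - z‖) := by
  have hfactor : cexp z' - cexp z = cexp z * (cexp (z' - z) - 1) := by
    rw [mul_sub, ← Complex.exp_add, add_sub_cancel, mul_one]
  have hone : ‖cexp (z' - z) - 1‖ ≤ ‖z' - z‖ * Real.exp ‖z' - z‖ := by
    simpa using Complex.norm_exp_sub_sum_le_norm_mul_exp (z' - z) 1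
  rw [hfactor, norm_mul, Real.exp_add, mul_left_comm]
  exact mul_le_mul (norm_exp_le_exp_norm z) hone (norm_nonneg _) (Real.exp_pos _).le

theorem norm_sum_Icc_le_of_geometric (ha : 0 ≤ a) (hq : 0 < q) (hq' : q ≤ 1 / 16)
    (hy : ∀ m, 3 ≤ m → ‖y m‖ ≤ a * q ^ (m - 2)) :
    ‖∑ m : Finset.Icc 3 N, y m‖ ≤ a / 8 :=
  calc _ ≤ ∑ m : Finset.Icc 3 N, a * (1 / 16) ^ ((m : ℕ) - 2) :=
        norm_sum_le_of_le _ fun m _ => (hy m (Finset.mem_Icc.mp m.2).1).trans (by gcongr)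
    _ ≤ a * (1 / 8) := by
        rw [← Finset.mul_sum]
        exact mul_le_mul_of_nonneg_left (sum_Icc_pow_le N) ha
    _ = a / 8 := by ring

theorem norm_cexp_sub_edgeworthExp_le (hN : 2 ≤ N) (ha : 0 ≤ a) (hq : 0 < q) (hq' : q ≤ 1 / 16)
    (hy : ∀ m, 3 ≤ m → ‖y m‖ ≤ a * q ^ (m - 2)) {s : ℂ} (hs : HasSum (fun j => y (j + 3)) s) :
    ‖cexp s - edgeworthExp N y‖ ≤ q ^ (N - 1) * ((2 * a + 16 ^ (N - 1)) * Real.exp (a / 4)) := by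
  have hsplit : s - ∑ m : Finset.Icc 3 N, y m = ∑' j, y (j + (N + 1)) := by
    rw [← hs.tsum_eq, ← hs.summable.sum_add_tsum_nat_add (N - 2),
      Finset.sum_coe_sort (Finset.Icc 3 N) y, ← Finset.Ico_add_one_right_eq_Icc,
      Finset.sum_Ico_eq_sum_range, show N + 1 - 3 = N - 2 by omega]
    simp_rw [add_comm 3, add_sub_cancel_left, add_assoc, show N - 2 + 3 = N + 1 by omega]
  have htail := norm_tsum_nat_add_le_of_geometric hN ha hq hq' hy
  have htail' : 2 * a * q ^ (N - 1) ≤ a / 8 := by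
    have : q ^ (N - 1) ≤ q := pow_le_of_le_one hq.le (by linarith) (by omega)
    nlinarith
  have hexp : ‖cexp s - cexp (∑ m : Finset.Icc 3 N, y m)‖ ≤
      2 * a * q ^ (N - 1) * Real.exp (a / 4) := by
    refine norm_cexp_sub_cexp_le.trans ?_
    rw [hsplit]
    gcongr
    linarith [norm_sum_Icc_le_of_geometric (N := N) ha hq hq' hy]
  calc _ ≤ 2 * a * q ^ (N - 1) * Real.exp (a / 4) + (16 * q) ^ (N - 1) * Real.exp (a / 4) :=
        (norm_sub_le_norm_sub_add_norm_sub _ _ _).trans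
          (add_le_add hexp (norm_cexp_sum_sub_edgeworthExp_le_of_geometric ha hq hq' hy))
    _ = _ := by ring

theorem norm_cexp_sub_gaussian_mul_edgeworthExp_le (hN : 2 ≤ N) {c : ℕ → ℝ} (h0 : c 0 = 0)
    (h1 : c 1 = 0) (h2 : c 2 = 1 / 2) {θ : ℝ} (hθ : 0 < θ)
    (hc : ∀ m, 3 ≤ m → |c m| ≤ θ ^ (m - 2)) {t : ℝ} (ht : t ≠ 0) (hθt : θ * |t| ≤ 1 / 16) {s : ℂ}
    (hs : HasSum (fun m => (c m : ℂ) * (t * I) ^ m) s) :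
    ‖cexp s - cexp (-(t ^ 2 / 2)) * edgeworthExp N fun m => (c m : ℂ) * (t * I) ^ m‖ ≤
      (θ * |t|) ^ (N - 1) * ((2 * t ^ 2 + 16 ^ (N - 1)) * Real.exp (-(t ^ 2 / 4))) := by
  have hy : ∀ m, 3 ≤ m → ‖(c m : ℂ) * (t * I) ^ m‖ ≤ t ^ 2 * (θ * |t|) ^ (m - 2) := by
    intro m hm
    obtain ⟨j, rfl⟩ := Nat.exists_eq_add_of_le (show 2 ≤ m by omega)
    calc _ = |c (2 + j)| * |t| ^ (2 + j) := by simp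
      _ ≤ θ ^ (2 + j - 2) * |t| ^ (2 + j) := by gcongr; exact hc _ hm
      _ = _ := by
        rw [pow_add, sq_abs, mul_pow, Nat.add_sub_cancel_left]
        ring
  have hs' : HasSum (fun j => (c (j + 3) : ℂ) * (t * I) ^ (j + 3)) (s + t ^ 2 / 2) := by
    have h := (hasSum_nat_add_iff' 3).mpr hs
    convert! h using 1
    simp only [Finset.sum_range_succ, Finset.sum_range_zero, h0, h1, h2, mul_pow, I_sq]
    push_cast
    ring
  have hfactor : cexp s = cexp (-(t ^ 2 / 2)) * cexp (s + t ^ 2 / 2) := by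
    rw [← Complex.exp_add]
    ring_nf
  rw [hfactor, ← mul_sub, norm_mul, norm_cexp_neg_sq_div_two]
  calc _ ≤ Real.exp (-(t ^ 2 / 2)) * ((θ * |t|) ^ (N - 1) *
        ((2 * t ^ 2 + 16 ^ (N - 1)) * Real.exp (t ^ 2 / 4))) := by
        gcongr
        exact norm_cexp_sub_edgeworthExp_le hN (sq_nonneg t)
          (mul_pos hθ (abs_pos.mpr ht)) hθt hy hs'
    _ = (θ * |t|) ^ (N - 1) * ((2 * t ^ 2 + 16 ^ (N - 1)) *
        (Real.exp (-(t ^ 2 / 2)) * Real.exp (t ^ 2 / 4))) := by ring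
    _ = _ := by
        rw [← Real.exp_add]
        ring_nf

end Truncation

/-! ### The Edgeworth expansion of a law -/

section Edgeworth

variable {N : ℕ} {g : ℝ → ℝ} {κ : ℕ → ℝ} {θ : ℝ}

/-- The function which dominates the difference of the two Fourier transforms in the Edgeworth
expansion, divided by `θ ^ (N - 1) * |t|`: the first summand is used where `θ * |t| ≤ 1 / 16`, and
the second one, in which `g` bounds the characteristic function, elsewhere. -/
noncomputable def edgeworthMajorant (N : ℕ) (g : ℝ → ℝ) (t : ℝ) : ℝ :=
  |t| ^ (N - 2) * ((2 * t ^ 2 + 16 ^ (N - 1)) * Real.exp (-(t ^ 2 / 4)) +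
    16 ^ (N - 1) * (g t + Real.exp (-(t ^ 2 / 2)) *
      (1 + ∑ k ∈ indexSet N, |t| ^ (∑ m : Finset.Icc 3 N, (m : ℕ) * k m))))

theorem integrable_abs_pow_mul_exp_neg_sq_div (n : ℕ) {b : ℝ} (hb : 0 < b) :
    Integrable fun t : ℝ => |t| ^ n * Real.exp (-(t ^ 2 / b)) := by
  have hn : (-1 : ℝ) < n := neg_one_lt_zero.trans_le n.cast_nonneg
  refine (integrable_rpow_mul_exp_neg_mul_sq (inv_pos.mpr hb) hn).norm.congr
    (ae_of_all _ fun t => ?_)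
  dsimp only
  rw [Real.rpow_natCast, norm_mul, norm_pow, Real.norm_eq_abs, Real.norm_eq_abs, Real.abs_exp,
    neg_mul, inv_mul_eq_div]

theorem integrable_edgeworthMajorant (hg : Integrable fun t => |t| ^ (N - 2) * g t) :
    Integrable (edgeworthMajorant N g) := by
  have hnear := ((integrable_abs_pow_mul_exp_neg_sq_div (N - 2 + 2) (b := 4)
    (by norm_num)).const_mul 2).add ((integrable_abs_pow_mul_exp_neg_sq_div (N - 2) (b := 4)
    (by norm_num)).const_mul (16 ^ (N - 1)))
  have hfar := ((integrable_abs_pow_mul_exp_neg_sq_div (N - 2) two_pos).add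
    (integrable_finsetSum (indexSet N) fun k _ => integrable_abs_pow_mul_exp_neg_sq_div
      (N - 2 + ∑ m : Finset.Icc 3 N, (m : ℕ) * k m) two_pos)).const_mul (16 ^ (N - 1))
  refine ((hnear.add (hg.const_mul (16 ^ (N - 1)))).add hfar).congr (ae_of_all _ fun t => ?_)
  simp only [Pi.add_apply, edgeworthMajorant, pow_add, sq_abs, ← Finset.sum_mul, ← Finset.mul_sum]
  ring

theorem norm_edgeworthExp_le {c : ℕ → ℝ} (hc : ∀ m, 3 ≤ m → |c m| ≤ 1) (t : ℝ) :
    ‖edgeworthExp N fun m => (c m : ℂ) * (t * I) ^ m‖ ≤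
      1 + ∑ k ∈ indexSet N, |t| ^ (∑ m : Finset.Icc 3 N, (m : ℕ) * k m) := by
  refine (norm_add_le _ _).trans ?_
  rw [norm_one]
  gcongr
  refine norm_sum_le_of_le _ fun k _ => ?_
  rw [norm_prod, ← Finset.prod_pow_eq_pow_sum]
  refine Finset.prod_le_prod (fun m _ => norm_nonneg _) fun m _ => ?_
  calc _ = (|c m| * |t| ^ (m : ℕ)) ^ k m / (k m).factorial := by simp
    _ ≤ (|c m| * |t| ^ (m : ℕ)) ^ k m :=
      div_le_self (by positivity) (Nat.one_le_cast.mpr (Nat.factorial_pos _))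
    _ ≤ (1 * |t| ^ (m : ℕ)) ^ k m := by
      gcongr
      exact hc m (Finset.mem_Icc.mp m.2).1
    _ = _ := by rw [one_mul, pow_mul]

theorem pow_mul_edgeworthMajorant_mul_abs (hN : 2 ≤ N) (t : ℝ) :
    θ ^ (N - 1) * edgeworthMajorant N g t * |t| = (θ * |t|) ^ (N - 1) *
      ((2 * t ^ 2 + 16 ^ (N - 1)) * Real.exp (-(t ^ 2 / 4))) + (16 * (θ * |t|)) ^ (N - 1) *
      (g t + Real.exp (-(t ^ 2 / 2)) *
        (1 + ∑ k ∈ indexSet N, |t| ^ (∑ m : Finset.Icc 3 N, (m : ℕ) * k m))) := by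
  obtain ⟨j, rfl⟩ := Nat.exists_eq_add_of_le hN
  rw [edgeworthMajorant, show 2 + j - 1 = j + 1 by omega, show 2 + j - 2 = j by omega, mul_pow,
    mul_pow, mul_pow]
  ring

theorem norm_charFun_sub_edgeworth_le (hN : 2 ≤ N) {μ : Measure ℝ}
    (h0 : κ 0 = 0) (h1 : κ 1 = 0) (h2 : κ 2 = 1) (hθ : 0 < θ) (hθ1 : θ ≤ 1)
    (hκ : ∀ m, 3 ≤ m → |κ m / m.factorial| ≤ θ ^ (m - 2))
    (hnear : ∀ t, θ * |t| ≤ 1 / 16 → ∃ s,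
      HasSum (fun m => ((κ m / m.factorial : ℝ) : ℂ) * (t * I) ^ m) s ∧ charFun μ t = cexp s)
    (hfar : ∀ t, ‖charFun μ t‖ ≤ g t) {t : ℝ} (ht : t ≠ 0) :
    ‖charFun μ t - weightedCharFun volume (edgeworthDensity N κ) t‖ ≤
      θ ^ (N - 1) * edgeworthMajorant N g t * |t| := by
  have hg : 0 ≤ g t := (norm_nonneg _).trans (hfar t)
  have : 0 ≤ ∑ k ∈ indexSet N, |t| ^ (∑ m : Finset.Icc 3 N, (m : ℕ) * k m) :=
    Finset.sum_nonneg fun _ _ => by positivity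
  rw [weightedCharFun_edgeworthDensity, pow_mul_edgeworthMajorant_mul_abs hN]
  rcases le_or_gt (θ * |t|) (1 / 16) with hsmall | hlarge
  · obtain ⟨s, hs, hφ⟩ := hnear t hsmall
    rw [hφ]
    exact le_add_of_le_of_nonneg (norm_cexp_sub_gaussian_mul_edgeworthExp_le hN (by simp [h0])
      (by simp [h1]) (by simp [h2]) hθ hκ ht hsmall hs) (by positivity)
  · have hone : 1 ≤ (16 * (θ * |t|)) ^ (N - 1) := one_le_pow₀ (by linarith)
    have hbound := norm_edgeworthExp_le (N := N)
      (fun m hm => (hκ m hm).trans (pow_le_one₀ hθ.le hθ1)) t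
    refine (norm_sub_le _ _).trans ?_
    rw [norm_mul, norm_cexp_neg_sq_div_two]
    refine le_add_of_nonneg_of_le (by positivity) (le_trans ?_ (le_mul_of_one_le_left
      (by positivity) hone))
    gcongr
    exact hfar t

theorem abs_measureReal_Iic_sub_edgeworth_le (hN : 2 ≤ N) {μ : Measure ℝ} [IsFiniteMeasure μ]
    (h0 : κ 0 = 0) (h1 : κ 1 = 0) (h2 : κ 2 = 1) (hθ : 0 < θ) (hθ1 : θ ≤ 1)
    (hκ : ∀ m, 3 ≤ m → |κ m / m.factorial| ≤ θ ^ (m - 2))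
    (hnear : ∀ t, θ * |t| ≤ 1 / 16 → ∃ s,
      HasSum (fun m => ((κ m / m.factorial : ℝ) : ℂ) * (t * I) ^ m) s ∧ charFun μ t = cexp s)
    (hfar : ∀ t, ‖charFun μ t‖ ≤ g t) (hg : Integrable fun t => |t| ^ (N - 2) * g t) (x : ℝ) :
    |μ.real (Set.Iic x) - edgeworth N κ x| ≤
      Real.pi⁻¹ * (∫ t, edgeworthMajorant N g t) * θ ^ (N - 1) := by
  have h := abs_setIntegral_Iic_sub_le (w₁ := 1) (ν₁ := μ) (integrable_const 1)
    (integrable_edgeworthDensity N κ) ((integrable_edgeworthMajorant hg).const_mul (θ ^ (N - 1)))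
    (fun t ht => by
      rw [weightedCharFun_one]
      exact norm_charFun_sub_edgeworth_le hN h0 h1 h2 hθ hθ1 hκ hnear hfar ht) x
  rw [integral_Iic_edgeworthDensity, integral_const_mul] at h
  calc _ ≤ _ := by simpa using h
    _ = _ := by ring

end Edgeworth

/-! ### Cumulants and the characteristic function -/

section Cumulant

variable {Ω : Type*} [MeasurableSpace Ω] {P : Measure Ω} {Y : Ω → ℝ} {c : ℕ → ℝ}

theorem frequently_nhdsNE_zero_of_eventually_mul {p : ℂ → Prop} {w : ℂ} (hw : w ≠ 0)
    (h : ∀ᶠ t : ℝ in 𝓝 0, p (t * w)) : ∃ᶠ z in 𝓝[≠] 0, p z := by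
  have hlim : Tendsto (fun t : ℝ => (t : ℂ) * w) (𝓝[≠] 0) (𝓝[≠] 0) := by
    refine tendsto_nhdsWithin_iff.mpr
      ⟨(Continuous.tendsto' (by fun_prop) _ _ (by simp)).mono_left nhdsWithin_le_nhds, ?_⟩
    filter_upwards [self_mem_nhdsWithin] with t ht
    exact mul_ne_zero (ofReal_ne_zero.mpr ht) hw
  exact hlim.frequently (h.filter_mono nhdsWithin_le_nhds).frequently

theorem hasFPowerSeriesAt_tsum_mul_pow {c : ℕ → ℂ} {z₀ : ℂ} (hz₀ : z₀ ≠ 0)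
    (h : Summable fun m => c m * z₀ ^ m) :
    HasFPowerSeriesAt (fun z => ∑' m, c m * z ^ m) (.ofScalars ℂ c) 0 := by
  have hradius : (‖z₀‖₊ : ENNReal) ≤ (FormalMultilinearSeries.ofScalars ℂ c).radius := by
    refine FormalMultilinearSeries.le_radius_of_tendsto _ (l := 0) ?_
    simpa using h.tendsto_atTop_zero.norm
  have hpos : 0 < (FormalMultilinearSeries.ofScalars ℂ c).radius :=
    lt_of_lt_of_le (by simpa using hz₀) hradius
  refine ((FormalMultilinearSeries.hasFPowerSeriesOnBall _ hpos).hasFPowerSeriesAt).congr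
    (.of_forall fun z => ?_)
  simp [FormalMultilinearSeries.sum, mul_comm]

theorem eventually_complexMGF_eq (hY : AEMeasurable Y P)
    (h0 : 0 ∈ interior (integrableExpSet Y P))
    (h : ∀ᶠ t : ℝ in 𝓝 0, ∃ s,
      HasSum (fun m => (c m : ℂ) * (t * I) ^ m) s ∧ charFun (P.map Y) t = cexp s) :
    ∀ᶠ z in 𝓝 0, HasSum (fun m => (c m : ℂ) * z ^ m) (∑' m, (c m : ℂ) * z ^ m) ∧
      complexMGF Y P z = cexp (∑' m, (c m : ℂ) * z ^ m) := by
  obtain ⟨z₀, ⟨s₀, hs₀⟩, hz₀⟩ := ((frequently_nhdsNE_zero_of_eventually_mul I_ne_zero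
    (p := fun z => Summable fun m => (c m : ℂ) * z ^ m)
    (h.mono fun t ⟨s, hs, _⟩ => hs.summable)).and_eventually self_mem_nhdsWithin).exists
  have hS := hasFPowerSeriesAt_tsum_mul_pow hz₀ ⟨s₀, hs₀⟩
  have hsum : ∀ᶠ z in 𝓝 0, HasSum (fun m => (c m : ℂ) * z ^ m) (∑' m, (c m : ℂ) * z ^ m) := by
    filter_upwards [hasFPowerSeriesAt_iff.mp hS] with z hz
    simpa [FormalMultilinearSeries.coeff_ofScalars, mul_comm] using hz
  refine hsum.and (((analyticAt_complexMGF (by simpa using h0)).frequently_eq_iff_eventually_eq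
    hS.analyticAt.cexp).mp (frequently_nhdsNE_zero_of_eventually_mul I_ne_zero ?_))
  filter_upwards [h] with t ⟨s, hs, hφ⟩
  rw [complexMGF_mul_I hY, hφ, Function.comp_apply, hs.tsum_eq]

theorem eventually_hasSum_cgf (hY : AEMeasurable Y P)
    (h0 : 0 ∈ interior (integrableExpSet Y P))
    (h : ∀ᶠ t : ℝ in 𝓝 0, ∃ s,
      HasSum (fun m => (c m : ℂ) * (t * I) ^ m) s ∧ charFun (P.map Y) t = cexp s) :
    ∀ᶠ t in 𝓝 0, HasSum (fun m => c m * t ^ m) (cgf Y P t) := by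
  have hreal : Tendsto (fun t : ℝ => (t : ℂ)) (𝓝 0) (𝓝 0) :=
    Complex.continuous_ofReal.tendsto' 0 0 ofReal_zero
  filter_upwards [hreal.eventually (eventually_complexMGF_eq hY h0 h)] with t ⟨hsum, hmgf⟩
  have hS : ∑' m, (c m : ℂ) * (t : ℂ) ^ m = ((∑' m, c m * t ^ m : ℝ) : ℂ) := by
    push_cast
    rfl
  rw [hS] at hsum hmgf
  rw [complexMGF_ofReal, ← ofReal_exp, ofReal_inj] at hmgf
  rw [cgf, hmgf, Real.log_exp]
  exact_mod_cast hsum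

/-- The power series of the logarithm of the characteristic function is that of the cumulant
generating function, by analytic continuation from the imaginary axis. -/
theorem cumulant_eq_of_charFun (hY : AEMeasurable Y P)
    (h0 : 0 ∈ interior (integrableExpSet Y P))
    (h : ∀ᶠ t : ℝ in 𝓝 0, ∃ s,
      HasSum (fun m => (c m : ℂ) * (t * I) ^ m) s ∧ charFun (P.map Y) t = cexp s) (k : ℕ) :
    cumulant P Y k = k.factorial * c k := by
  have hps : HasFPowerSeriesAt (cgf Y P) (.ofScalars ℝ c) 0 := by
    refine hasFPowerSeriesAt_iff.mpr ?_
    filter_upwards [eventually_hasSum_cgf hY h0 h] with t ht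
    simpa [FormalMultilinearSeries.coeff_ofScalars, mul_comm] using ht
  have hcoeff := congrFun (FormalMultilinearSeries.ofScalars_series_injective ℝ ℝ
    (hps.analyticAt.hasFPowerSeriesAt.eq_formalMultilinearSeries hps)) k
  rw [cumulant, ← hcoeff, mul_div_cancel₀ _ (by positivity)]

variable [IsProbabilityMeasure P]

theorem cumulant_one (h0 : 0 ∈ interior (integrableExpSet Y P)) :
    cumulant P Y 1 = ∫ ω, Y ω ∂P := by
  simp [cumulant, iteratedDeriv_one, deriv_cgf_zero h0]

theorem cumulant_two (h0 : 0 ∈ interior (integrableExpSet Y P)) :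
    cumulant P Y 2 = variance Y P := by
  rw [cumulant, iteratedDeriv_two_cgf_eq_integral h0, deriv_cgf_zero h0, variance_eq_integral
    (integrable_of_mem_interior_integrableExpSet h0).aemeasurable]
  simp

end Cumulant

/-! ### The centered gamma law -/

section CenteredGamma

theorem integral_gammaMeasure {E : Type*} [NormedAddCommGroup E] [NormedSpace ℝ E] {a r : ℝ}
    (ha : 0 < a) (hr : 0 < r) (f : ℝ → E) :
    ∫ x, f x ∂(gammaMeasure a r) =
      ∫ x in Set.Ioi 0, (r ^ a / Real.Gamma a * x ^ (a - 1) * Real.exp (-(r * x))) • f x := by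
  rw [gammaMeasure, integral_withDensity_eq_integral_toReal_smul (f := gammaPDF a r)
    (measurable_gammaPDFReal a r).ennreal_ofReal (ae_of_all _ fun x => ENNReal.ofReal_lt_top),
    ← integral_Ici_eq_integral_Ioi, ← integral_indicator measurableSet_Ici]
  congr 1 with x
  rw [gammaPDF, ENNReal.toReal_ofReal (gammaPDFReal_nonneg ha hr x), gammaPDFReal]
  by_cases hx : 0 ≤ x
  · rw [if_pos hx, Set.indicator_of_mem (Set.mem_Ici.mpr hx)]
  · rw [if_neg hx, Set.indicator_of_notMem (by simpa using hx), zero_smul]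

variable {a r : ℝ} {t : ℝ} {z : ℂ}

theorem mgf_id_gammaMeasure (ha : 0 < a) (hr : 0 < r) (ht : t < r) :
    mgf id (gammaMeasure a r) t = Real.exp (-(a * Real.log (1 - t / r))) := by
  have hrt : 0 < r - t := sub_pos.mpr ht
  have hquot : 1 - t / r = (r - t) / r := by field_simp
  calc mgf id (gammaMeasure a r) t
      = ∫ x in Set.Ioi 0, r ^ a / Real.Gamma a * (x ^ (a - 1) * Real.exp (-((r - t) * x))) := by
        rw [mgf, integral_gammaMeasure ha hr]
        refine integral_congr_ae (ae_of_all _ fun x => ?_)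
        simp only [smul_eq_mul, id, mul_assoc, ← Real.exp_add]
        ring_nf
    _ = (r / (r - t)) ^ a := by
        rw [integral_const_mul, Real.integral_rpow_mul_exp_neg_mul_Ioi ha hrt,
          Real.div_rpow zero_le_one hrt.le, Real.one_rpow, Real.div_rpow hr.le hrt.le]
        field_simp [(Real.Gamma_pos_of_pos ha).ne']
    _ = Real.exp (-(a * Real.log (1 - t / r))) := by
        rw [hquot, Real.rpow_def_of_pos (div_pos hr hrt), ← inv_div, Real.log_inv]
        ring_nf

theorem Iio_subset_integrableExpSet_gammaMeasure (ha : 0 < a) (hr : 0 < r) :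
    Set.Iio r ⊆ integrableExpSet id (gammaMeasure a r) := fun t ht => by
  refine Integrable.of_integral_ne_zero (ne_of_gt ?_)
  exact (Real.exp_pos _).trans_eq (mgf_id_gammaMeasure ha hr ht).symm

theorem one_sub_div_mem_slitPlane (hr : 0 < r) (hz : z.re < r) : 1 - z / r ∈ slitPlane := by
  refine Or.inl ?_
  rwa [sub_re, one_re, div_ofReal_re, sub_pos, div_lt_one hr]

theorem complexMGF_id_gammaMeasure (ha : 0 < a) (hr : 0 < r) (hz : z.re < r) :
    complexMGF id (gammaMeasure a r) z = cexp (-(a * log (1 - z / r))) := by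
  have hmgf : AnalyticOnNhd ℂ (complexMGF id (gammaMeasure a r)) {w | w.re < r} := fun w hw =>
    analyticAt_complexMGF (mem_interior.mpr
      ⟨_, Iio_subset_integrableExpSet_gammaMeasure ha hr, isOpen_Iio, hw⟩)
  have hexp : AnalyticOnNhd ℂ (fun w => cexp (-(a * log (1 - w / r)))) {w | w.re < r} :=
    fun w hw => by
      have := one_sub_div_mem_slitPlane hr hw
      fun_prop (disch := assumption)
  refine hmgf.eqOn_of_preconnected_of_frequently_eq hexp
    (convex_halfSpace_re_lt r).isPreconnected (z₀ := 0) (by simpa using hr)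
    (frequently_nhdsNE_zero_of_eventually_mul one_ne_zero ?_) hz
  filter_upwards [eventually_lt_nhds hr] with t ht
  have hpos : 0 ≤ 1 - t / r := sub_nonneg.mpr ((div_le_one hr).mpr ht.le)
  rw [mul_one, complexMGF_ofReal, mgf_id_gammaMeasure ha hr ht, ofReal_exp]
  push_cast [ofReal_log hpos]
  rfl

/-- The law of `η - 1` where `η` is a gamma variable of shape and rate `r`, hence of mean `1`. -/
noncomputable def centeredGamma (r : ℝ) : Measure ℝ :=
  (gammaMeasure r r).map (· - 1)

/-- The logarithm of the complex moment generating function of `centeredGamma r`. -/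
noncomputable def gammaExponent (r : ℝ) (z : ℂ) : ℂ :=
  -(r * log (1 - z / r)) - z

/-- The coefficients of the power series of `gammaExponent r` at `0`. -/
noncomputable def gammaCoeff (r : ℝ) (m : ℕ) : ℝ :=
  if m < 2 then 0 else (r ^ (m - 1) * m)⁻¹

theorem gammaCoeff_nonneg (hr : 0 < r) (m : ℕ) : 0 ≤ gammaCoeff r m := by
  rw [gammaCoeff]
  split_ifs <;> positivity

theorem hasSum_gammaExponent (hr : 0 < r) (hz : ‖z‖ < r) :
    HasSum (fun m => (gammaCoeff r m : ℂ) * z ^ m) (gammaExponent r z) := by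
  have hr' : (r : ℂ) ≠ 0 := ofReal_ne_zero.mpr hr.ne'
  have hdiv : ‖z / r‖ < 1 := by
    rwa [norm_div, norm_real, Real.norm_of_nonneg hr.le, div_lt_one hr]
  have hlog := ((hasSum_taylorSeries_neg_log hdiv).mul_left (r : ℂ)).sub (hasSum_ite_eq 1 z)
  rw [mul_neg] at hlog
  refine hlog.congr_fun fun m => ?_
  rcases m with _ | _ | m
  · simp [gammaCoeff]
  · simp [gammaCoeff, mul_div_cancel₀ _ hr']
  · have hm : (m : ℂ) + 1 + 1 ≠ 0 := by exact_mod_cast (m + 1).succ_ne_zero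
    rw [gammaCoeff, if_neg (by omega), if_neg (by omega), Nat.add_sub_cancel, sub_zero, div_pow,
      pow_succ (r : ℂ)]
    push_cast
    field_simp

theorem norm_gammaExponent_le (hr : 0 < r) (hz : ‖z‖ ≤ r / 2) :
    ‖gammaExponent r z‖ ≤ ‖z‖ ^ 2 / r := by
  have hr' : (r : ℂ) ≠ 0 := ofReal_ne_zero.mpr hr.ne'
  have hnorm : ‖-(z / r)‖ = ‖z‖ / r := by
    rw [norm_neg, norm_div, norm_real, Real.norm_of_nonneg hr.le]
  have hhalf : ‖z‖ / r ≤ 1 / 2 := by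
    rw [div_le_iff₀ hr]
    linarith
  have hinv : (1 - ‖z‖ / r)⁻¹ ≤ 2 := inv_le_of_inv_le₀ two_pos (by linarith)
  have hlog := norm_log_one_add_sub_self_le (z := -(z / r)) (by rw [hnorm]; linarith)
  rw [hnorm] at hlog
  calc ‖gammaExponent r z‖ = ‖(r : ℂ) * (log (1 + -(z / r)) - -(z / r))‖ := by
        rw [gammaExponent, ← sub_eq_add_neg, ← norm_neg]
        congr 1
        field_simp
        ring
    _ ≤ r * ((‖z‖ / r) ^ 2 * 2 / 2) := by
        rw [norm_mul, norm_real, Real.norm_of_nonneg hr.le]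
        gcongr
        exact hlog.trans (by gcongr)
    _ = ‖z‖ ^ 2 / r := by field_simp

theorem norm_exp_gammaExponent_mul_I (r s : ℝ) :
    ‖cexp (gammaExponent r (s * I))‖ = (1 + s ^ 2 / r ^ 2) ^ (-(r / 2)) := by
  have hpos : 0 < 1 + s ^ 2 / r ^ 2 := by positivity
  have hnorm : ‖1 - s * I / r‖ = Real.sqrt (1 + s ^ 2 / r ^ 2) := by
    have : 1 - s * I / r = (1 : ℝ) + (-(s / r) : ℝ) * I := by
      push_cast
      ring
    rw [this, norm_add_mul_I]
    ring_nf
  have hre : (gammaExponent r (s * I)).re = -(r * Real.log ‖1 - s * I / r‖) := by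
    simp [gammaExponent, log_re]
  rw [norm_exp, hre, hnorm, Real.log_sqrt hpos.le, Real.rpow_def_of_pos hpos]
  ring_nf

theorem complexMGF_id_centeredGamma (hr : 0 < r) (hz : z.re < r) :
    complexMGF id (centeredGamma r) z = cexp (gammaExponent r z) := by
  have hshift : complexMGF id (centeredGamma r) z =
      complexMGF id (gammaMeasure r r) z * cexp (-z) := by
    rw [centeredGamma, complexMGF_id_map (by fun_prop), complexMGF, complexMGF,
      ← integral_mul_const]
    congr 1 with x
    rw [← Complex.exp_add, id]
    push_cast
    ring_nf
  rw [hshift, complexMGF_id_gammaMeasure hr hr hz, gammaExponent, ← Complex.exp_add,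
    sub_eq_add_neg _ z]

theorem charFun_centeredGamma (hr : 0 < r) (t : ℝ) :
    charFun (centeredGamma r) t = cexp (gammaExponent r (t * I)) := by
  rw [← complexMGF_id_mul_I, complexMGF_id_centeredGamma hr (by simpa using hr)]

theorem Iio_subset_integrableExpSet_centeredGamma (hr : 0 < r) :
    Set.Iio r ⊆ integrableExpSet id (centeredGamma r) := fun t ht => by
  refine Integrable.of_integral_ne_zero fun h => ?_
  have := complexMGF_id_centeredGamma hr (z := t) (by simpa using ht)
  rw [complexMGF_ofReal, mgf, h, ofReal_zero] at this
  exact Complex.exp_ne_zero _ this.symm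

theorem zero_mem_interior_integrableExpSet_centeredGamma (hr : 0 < r) :
    0 ∈ interior (integrableExpSet id (centeredGamma r)) :=
  mem_interior.mpr ⟨_, Iio_subset_integrableExpSet_centeredGamma hr, isOpen_Iio, hr⟩

theorem mgf_id_centeredGamma_le (hr : 0 < r) (ht : |t| ≤ r / 2) :
    mgf id (centeredGamma r) t ≤ Real.exp (t ^ 2 / r) := by
  have hre : (t : ℂ).re < r := by
    rw [ofReal_re]
    linarith [le_abs_self t]
  have hnorm : ‖(t : ℂ)‖ = |t| := norm_real t
  calc mgf id (centeredGamma r) t ≤ ‖(mgf id (centeredGamma r) t : ℂ)‖ := by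
        rw [norm_real]
        exact le_abs_self _
    _ = ‖cexp (gammaExponent r t)‖ := by
        rw [← complexMGF_ofReal, complexMGF_id_centeredGamma hr hre]
    _ ≤ Real.exp ‖gammaExponent r t‖ := norm_exp_le_exp_norm _
    _ ≤ Real.exp (t ^ 2 / r) := by
        rw [Real.exp_le_exp, ← sq_abs t, ← hnorm]
        exact norm_gammaExponent_le hr (by rwa [hnorm])

theorem isProbabilityMeasure_centeredGamma (hr : 0 < r) :
    IsProbabilityMeasure (centeredGamma r) :=
  have := isProbabilityMeasure_gammaMeasure hr hr
  Measure.isProbabilityMeasure_map (by fun_prop)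

theorem integral_id_centeredGamma (hr : 0 < r) : ∫ x, x ∂(centeredGamma r) = 0 := by
  have := isProbabilityMeasure_centeredGamma hr
  have h0 := zero_mem_interior_integrableExpSet_centeredGamma hr
  have hκ := cumulant_eq_of_charFun (c := gammaCoeff r) aemeasurable_id h0 (P := centeredGamma r)
    (by
      filter_upwards [Metric.ball_mem_nhds (0 : ℝ) hr] with t ht
      refine ⟨_, hasSum_gammaExponent hr ?_, ?_⟩
      · simpa using ht
      · rw [Measure.map_id, charFun_centeredGamma hr]) 1
  rw [cumulant_one h0] at hκ
  simpa [gammaCoeff] using hκ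

theorem memLp_two_id_centeredGamma (hr : 0 < r) : MemLp id 2 (centeredGamma r) :=
  memLp_of_mem_interior_integrableExpSet
    (zero_mem_interior_integrableExpSet_centeredGamma hr) 2

end CenteredGamma

/-! ### Series of independent random variables -/

section IndependentSeries

variable {Ω : Type*} [MeasurableSpace Ω] {P : Measure Ω} {X : ℕ → Ω → ℝ} {Y : Ω → ℝ}

theorem integrable_of_ae_tendsto_of_integral_norm_le {C : ℝ} (hX : ∀ n, Integrable (X n) P)
    (hC : ∀ n, ∫ ω, ‖X n ω‖ ∂P ≤ C)
    (hY : ∀ᵐ ω ∂P, Tendsto (fun n => X n ω) atTop (𝓝 (Y ω))) : Integrable Y P := by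
  rw [← memLp_one_iff_integrable]
  refine ⟨aestronglyMeasurable_of_tendsto_ae atTop (fun n => (hX n).aestronglyMeasurable) hY, ?_⟩
  refine (Lp.eLpNorm_lim_le_liminf_eLpNorm (fun n => (hX n).aestronglyMeasurable) Y hY).trans_lt
    ((liminf_le_of_frequently_le' (.of_forall fun n => ?_)).trans_lt
      (ENNReal.ofReal_lt_top (r := C)))
  rw [eLpNorm_one_eq_lintegral_enorm, ← ofReal_integral_norm_eq_lintegral_enorm (hX n)]
  exact ENNReal.ofReal_le_ofReal (hC n)

variable [IsProbabilityMeasure P]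

theorem tendsto_charFun_map_of_ae_tendsto (hX : ∀ n, AEMeasurable (X n) P)
    (hY : ∀ᵐ ω ∂P, Tendsto (fun n => X n ω) atTop (𝓝 (Y ω))) (t : ℝ) :
    Tendsto (fun n => charFun (P.map (X n)) t) atTop (𝓝 (charFun (P.map Y) t)) :=
  ProbabilityMeasure.tendsto_iff_tendsto_charFun.mp (tendstoInDistribution_of_ae_tendsto hX
    (aemeasurable_of_tendsto_metrizable_ae atTop hX hY) hY).tendsto t

theorem martingale_sum_of_iIndepFun (hm : ∀ j, StronglyMeasurable (X j))
    (hint : ∀ j, Integrable (X j) P) (hmean : ∀ j, ∫ ω, X j ω ∂P = 0) (hind : iIndepFun X P) :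
    Martingale (fun K ω => ∑ j ∈ Finset.range (K + 1), X j ω) (Filtration.natural X hm) P := by
  refine martingale_of_condExp_sub_eq_zero_nat (fun K => ?_)
    (fun K => integrable_finsetSum _ fun j _ => hint j) fun K => ?_
  · refine Finset.stronglyMeasurable_fun_sum _ fun j hj => ?_
    exact (Filtration.stronglyAdapted_natural hm j).mono
      (Filtration.mono _ (Nat.lt_succ_iff.mp (Finset.mem_range.mp hj)))
  · have hincr : ((fun ω => ∑ j ∈ Finset.range (K + 1 + 1), X j ω) -
        fun ω => ∑ j ∈ Finset.range (K + 1), X j ω) = X (K + 1) := by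
      ext ω
      simp [Finset.sum_range_succ _ (K + 1)]
    rw [hincr]
    filter_upwards [hind.condExp_natural_ae_eq_of_lt hm K.lt_succ_self] with ω hω
    rw [hω, hmean, Pi.zero_apply]

theorem integral_abs_le_one_add_variance (hY : MemLp Y 2 P) (hmean : ∫ ω, Y ω ∂P = 0) :
    ∫ ω, |Y ω| ∂P ≤ 1 + variance Y P := by
  rw [variance_of_integral_eq_zero hY.aemeasurable hmean]
  calc ∫ ω, |Y ω| ∂P ≤ ∫ ω, (1 + Y ω ^ 2) ∂P :=
        integral_mono (hY.integrable one_le_two).abs ((integrable_const 1).add hY.integrable_sq)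
          fun ω => by nlinarith [sq_abs (Y ω), sq_nonneg (|Y ω| - 1)]
    _ = 1 + ∫ ω, Y ω ^ 2 ∂P := by
        rw [integral_add (integrable_const 1) hY.integrable_sq]
        simp

theorem ae_exists_tendsto_sum_of_stronglyMeasurable (hm : ∀ j, StronglyMeasurable (X j))
    (hX : ∀ j, MemLp (X j) 2 P) (hmean : ∀ j, ∫ ω, X j ω ∂P = 0) (hind : iIndepFun X P)
    (hvar : Summable fun j => variance (X j) P) :
    ∀ᵐ ω ∂P, ∃ l, Tendsto (fun K => ∑ j ∈ Finset.range K, X j ω) atTop (𝓝 l) := by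
  have hint (j : ℕ) : Integrable (X j) P := (hX j).integrable one_le_two
  have hbdd (K : ℕ) : eLpNorm (fun ω => ∑ j ∈ Finset.range (K + 1), X j ω) 1 P ≤
      (1 + ∑' j, variance (X j) P).toNNReal := by
    have hsum : MemLp (fun ω => ∑ j ∈ Finset.range (K + 1), X j ω) 2 P :=
      memLp_finsetSum _ fun j _ => hX j
    rw [eLpNorm_one_eq_lintegral_enorm,
      ← ofReal_integral_norm_eq_lintegral_enorm (hsum.integrable one_le_two)]
    refine ENNReal.ofReal_le_ofReal ((integral_abs_le_one_add_variance hsum ?_).trans ?_)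
    · rw [integral_finsetSum _ fun j _ => hint j, Finset.sum_eq_zero fun j _ => hmean j]
    · rw [← Finset.sum_fn, IndepFun.variance_sum (fun j _ => hX j)
        fun i _ j _ hij => hind.indepFun hij]
      gcongr
      exact hvar.sum_le_tsum _ fun j _ => variance_nonneg _ _
  have hmart := martingale_sum_of_iIndepFun hm hint hmean hind
  filter_upwards [hmart.submartingale.exists_ae_tendsto_of_bdd hbdd] with ω ⟨l, hl⟩
  exact ⟨l, (tendsto_add_atTop_iff_nat 1).mp hl⟩

theorem ae_exists_tendsto_sum_of_iIndepFun (hX : ∀ j, MemLp (X j) 2 P)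
    (hmean : ∀ j, ∫ ω, X j ω ∂P = 0) (hind : iIndepFun X P)
    (hvar : Summable fun j => variance (X j) P) :
    ∀ᵐ ω ∂P, ∃ l, Tendsto (fun K => ∑ j ∈ Finset.range K, X j ω) atTop (𝓝 l) := by
  have hae (j : ℕ) : X j =ᵐ[P] (hX j).1.mk (X j) := (hX j).1.ae_eq_mk
  have hlim := ae_exists_tendsto_sum_of_stronglyMeasurable
    (fun j => (hX j).1.stronglyMeasurable_mk) (fun j => (hX j).ae_eq (hae j))
    (fun j => (integral_congr_ae (hae j)).symm.trans (hmean j)) ((iIndepFun_congr hae).mp hind)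
    (by simpa only [variance_congr (hae _)] using hvar)
  filter_upwards [hlim, ae_all_iff.mpr hae] with ω ⟨l, hl⟩ hω
  exact ⟨l, by simpa only [hω] using hl⟩

end IndependentSeries

/-! ### Series of independent centered gamma variables -/

section GammaSeries

variable {r : ℝ} {b : ℕ → ℝ}

/-- The coefficients of the cumulant generating function of the sum of `b j * ξ j`, where the
variables `ξ j` are independent of law `centeredGamma r`. -/
noncomputable def seriesCoeff (r : ℝ) (b : ℕ → ℝ) (m : ℕ) : ℝ :=
  gammaCoeff r m * ∑' j, b j ^ m

theorem norm_gammaCoeff_mul_pow_le (hr : 0 < r) {w : ℂ} (hw : ‖w‖ ≤ r / 2) (m : ℕ) :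
    ‖(gammaCoeff r m : ℂ) * w ^ m‖ ≤ 4 / r * ‖w‖ ^ 2 * (1 / 2) ^ m := by
  rw [norm_mul, norm_pow, norm_real, Real.norm_of_nonneg (gammaCoeff_nonneg hr m), gammaCoeff]
  split_ifs with hm
  · rw [zero_mul]
    positivity
  · obtain ⟨n, rfl⟩ := Nat.exists_eq_add_of_le (not_lt.mp hm)
    have hratio : ‖w‖ / r ≤ 1 / 2 := by
      rw [div_le_iff₀ hr]
      linarith
    have hcast : 1 ≤ ((2 + n : ℕ) : ℝ) := by exact_mod_cast (by omega : 1 ≤ 2 + n)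
    rw [show 2 + n - 1 = n + 1 by omega]
    calc (r ^ (n + 1) * ((2 + n : ℕ) : ℝ))⁻¹ * ‖w‖ ^ (2 + n)
        = ‖w‖ ^ 2 / r * (‖w‖ / r) ^ n * (((2 + n : ℕ) : ℝ))⁻¹ := by
          rw [div_pow, pow_succ, pow_add, mul_inv, mul_inv]
          ring
      _ ≤ ‖w‖ ^ 2 / r * (1 / 2) ^ n * 1 := by
          gcongr
          exact inv_le_one_of_one_le₀ hcast
      _ = 4 / r * ‖w‖ ^ 2 * (1 / 2) ^ (2 + n) := by
          rw [pow_add]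
          ring

theorem summable_pow_of_summable_sq (hb : Summable fun j => b j ^ 2) {m : ℕ} (hm : 2 ≤ m) :
    Summable fun j => b j ^ m := by
  refine hb.of_norm_bounded_eventually_nat ?_
  filter_upwards [hb.tendsto_atTop_zero.eventually_le_const one_pos] with j hj
  rw [norm_pow, Real.norm_eq_abs, ← sq_abs]
  exact pow_le_pow_of_le_one (abs_nonneg _) ((sq_le_one_iff_abs_le_one _).mp hj) hm

theorem summable_gammaCoeff_mul_pow (hr : 0 < r) (hb : Summable fun j => b j ^ 2) {z : ℂ}
    (hz : ∀ j, ‖b j * z‖ ≤ r / 2) :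
    Summable fun p : ℕ × ℕ => (gammaCoeff r p.2 : ℂ) * (b p.1 * z) ^ p.2 := by
  have hsq : Summable fun j => 4 / r * ‖b j * z‖ ^ 2 := by
    simpa [mul_pow, mul_assoc] using (hb.mul_right (‖z‖ ^ 2)).mul_left (4 / r)
  exact (hsq.mul_of_nonneg summable_geometric_two (fun j => by positivity)
    fun m => by positivity).of_norm_bounded fun p => norm_gammaCoeff_mul_pow_le hr (hz p.1) p.2

theorem hasSum_gammaCoeff_mul_pow (hb : Summable fun j => b j ^ 2) (z : ℂ) (m : ℕ) :
    HasSum (fun j => (gammaCoeff r m : ℂ) * (b j * z) ^ m) (seriesCoeff r b m * z ^ m) := by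
  by_cases hm : m < 2
  · simp [seriesCoeff, gammaCoeff, hm, hasSum_zero]
  · have hpow := hasSum_ofReal.mpr (summable_pow_of_summable_sq hb (not_lt.mp hm)).hasSum
    simpa [seriesCoeff, mul_pow, mul_assoc] using
      (hpow.mul_right (z ^ m)).mul_left (gammaCoeff r m : ℂ)

theorem exists_hasSum_seriesCoeff (hr : 0 < r) (hb : Summable fun j => b j ^ 2) {z : ℂ}
    (hz : ∀ j, ‖b j * z‖ ≤ r / 2) :
    ∃ s, HasSum (fun j => gammaExponent r (b j * z)) s ∧
      HasSum (fun m => (seriesCoeff r b m : ℂ) * z ^ m) s := by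
  have hsum := (summable_gammaCoeff_mul_pow hr hb hz).hasSum
  have hrow (j : ℕ) : HasSum (fun m => (gammaCoeff r m : ℂ) * (b j * z) ^ m)
      (gammaExponent r (b j * z)) :=
    hasSum_gammaExponent hr ((hz j).trans_lt (half_lt_self hr))
  exact ⟨_, hsum.prod_fiberwise hrow,
    HasSum.prod_fiberwise ((Equiv.prodComm ℕ ℕ).hasSum_iff.mpr hsum)
      (hasSum_gammaCoeff_mul_pow hb z)⟩

theorem eventually_forall_abs_mul_le (hb : Summable fun j => b j ^ 2) {c : ℝ} (hc : 0 < c) :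
    ∀ᶠ t in 𝓝 0, ∀ j, |b j * t| ≤ c := by
  have hlim : Tendsto (fun t : ℝ => (∑' j, b j ^ 2) * t ^ 2) (𝓝 0) (𝓝 0) :=
    Continuous.tendsto' (by fun_prop) _ _ (by simp)
  filter_upwards [hlim.eventually_le_const (pow_pos hc 2)] with t ht j
  refine abs_le_of_sq_le_sq ?_ hc.le
  rw [mul_pow]
  exact (mul_le_mul_of_nonneg_right (hb.le_tsum j fun _ _ => sq_nonneg _) (sq_nonneg t)).trans ht

variable {Ω : Type*} [MeasurableSpace Ω] {P : Measure Ω}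
  {ξ : ℕ → Ω → ℝ} {Y : Ω → ℝ}

theorem aemeasurable_of_ae_tendsto_sum_mul (hξ : ∀ j, HasLaw (ξ j) (centeredGamma r) P)
    (hY : ∀ᵐ ω ∂P, Tendsto (fun K => ∑ j ∈ Finset.range K, b j * ξ j ω) atTop (𝓝 (Y ω))) :
    AEMeasurable Y P :=
  aemeasurable_of_tendsto_metrizable_ae atTop (fun _ =>
    Finset.aemeasurable_fun_sum _ fun j _ => (hξ j).aemeasurable.const_mul _) hY

theorem mgf_sum_mul (hξ : ∀ j, HasLaw (ξ j) (centeredGamma r) P) (hind : iIndepFun ξ P) (K : ℕ)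
    (t : ℝ) : mgf (fun ω => ∑ j ∈ Finset.range K, b j * ξ j ω) P t =
      ∏ j ∈ Finset.range K, mgf id (centeredGamma r) (b j * t) := by
  have hindb := hind.comp (fun j x => b j * x) fun j => by fun_prop
  have hsum := hindb.mgf_sum₀ (t := t) (fun j => (hξ j).aemeasurable.const_mul (b j))
    (Finset.range K)
  rw [Finset.sum_fn] at hsum
  refine hsum.trans (Finset.prod_congr rfl fun j _ => ?_)
  rw [← (hξ j).map_eq, mgf_id_map (hξ j).aemeasurable, ← mgf_const_mul]
  rfl

theorem charFun_sum_mul (hr : 0 < r) (hξ : ∀ j, HasLaw (ξ j) (centeredGamma r) P)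
    (hind : iIndepFun ξ P) (K : ℕ) (t : ℝ) :
    charFun (P.map fun ω => ∑ j ∈ Finset.range K, b j * ξ j ω) t =
      ∏ j ∈ Finset.range K, cexp (gammaExponent r (b j * (t * I))) := by
  have hindb := hind.comp (fun j x => b j * x) fun j => by fun_prop
  have hsum := (hindb.restrict (Finset.range K)).charFun_map_fun_finsetSum_eq_prod
    fun j _ => (hξ j).aemeasurable.const_mul (b j)
  refine (congrFun hsum t).trans ?_
  rw [Finset.prod_apply]
  refine Finset.prod_congr rfl fun j _ => ?_
  rw [charFun_map_mul_comp (hξ j).aemeasurable, (hξ j).map_eq,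
    charFun_centeredGamma hr]
  push_cast
  ring_nf

theorem mgf_sum_mul_pos (hr : 0 < r) (hξ : ∀ j, HasLaw (ξ j) (centeredGamma r) P)
    (hind : iIndepFun ξ P) (K : ℕ) {t : ℝ} (ht : ∀ j, |b j * t| ≤ r / 2) :
    0 < mgf (fun ω => ∑ j ∈ Finset.range K, b j * ξ j ω) P t := by
  have := isProbabilityMeasure_centeredGamma hr
  rw [mgf_sum_mul hξ hind]
  refine Finset.prod_pos fun j _ => mgf_pos (Iio_subset_integrableExpSet_centeredGamma hr ?_)
  exact ((le_abs_self _).trans (ht j)).trans_lt (half_lt_self hr)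

theorem mgf_sum_mul_le (hr : 0 < r) (hξ : ∀ j, HasLaw (ξ j) (centeredGamma r) P)
    (hind : iIndepFun ξ P) (hb : Summable fun j => b j ^ 2) (K : ℕ) {t : ℝ}
    (ht : ∀ j, |b j * t| ≤ r / 2) :
    mgf (fun ω => ∑ j ∈ Finset.range K, b j * ξ j ω) P t ≤
      Real.exp (t ^ 2 / r * ∑' j, b j ^ 2) := by
  calc mgf (fun ω => ∑ j ∈ Finset.range K, b j * ξ j ω) P t
      ≤ ∏ j ∈ Finset.range K, Real.exp ((b j * t) ^ 2 / r) := by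
        rw [mgf_sum_mul hξ hind]
        exact Finset.prod_le_prod (fun j _ => mgf_nonneg) fun j _ =>
          mgf_id_centeredGamma_le hr (ht j)
    _ = Real.exp (t ^ 2 / r * ∑ j ∈ Finset.range K, b j ^ 2) := by
        rw [← Real.exp_sum, Finset.mul_sum]
        congr 1
        exact Finset.sum_congr rfl fun j _ => by ring
    _ ≤ Real.exp (t ^ 2 / r * ∑' j, b j ^ 2) := by
        gcongr
        exact hb.sum_le_tsum _ fun j _ => sq_nonneg _

theorem zero_mem_interior_integrableExpSet (hr : 0 < r)
    (hξ : ∀ j, HasLaw (ξ j) (centeredGamma r) P) (hind : iIndepFun ξ P)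
    (hb : Summable fun j => b j ^ 2)
    (hY : ∀ᵐ ω ∂P, Tendsto (fun K => ∑ j ∈ Finset.range K, b j * ξ j ω) atTop (𝓝 (Y ω))) :
    0 ∈ interior (integrableExpSet Y P) := by
  rw [mem_interior_iff_mem_nhds]
  filter_upwards [eventually_forall_abs_mul_le hb (half_pos hr)] with t ht
  refine integrable_of_ae_tendsto_of_integral_norm_le
    (X := fun K ω => Real.exp (t * ∑ j ∈ Finset.range K, b j * ξ j ω))
    (fun K => Integrable.of_integral_ne_zero (mgf_sum_mul_pos hr hξ hind K ht).ne')
    (fun K => ?_) ?_ (C := Real.exp (t ^ 2 / r * ∑' j, b j ^ 2))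
  · simp only [Real.norm_eq_abs, Real.abs_exp]
    exact mgf_sum_mul_le hr hξ hind hb K ht
  · filter_upwards [hY] with ω hω
    exact (Real.continuous_exp.tendsto _).comp (hω.const_mul t)

variable [IsProbabilityMeasure P]

theorem ae_exists_tendsto_sum_mul (hr : 0 < r) (hξ : ∀ j, HasLaw (ξ j) (centeredGamma r) P)
    (hind : iIndepFun ξ P) (hb : Summable fun j => b j ^ 2) :
    ∀ᵐ ω ∂P, ∃ l, Tendsto (fun K => ∑ j ∈ Finset.range K, b j * ξ j ω) atTop (𝓝 l) := by
  refine ae_exists_tendsto_sum_of_iIndepFun (fun j => ?_) (fun j => ?_)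
    (hind.comp (fun j x => b j * x) fun j => by fun_prop) ?_
  · have := memLp_two_id_centeredGamma hr
    rw [← (hξ j).map_eq, memLp_map_measure_iff (by fun_prop) (hξ j).aemeasurable] at this
    exact this.const_mul (b j)
  · rw [integral_const_mul, (hξ j).integral_eq, integral_id_centeredGamma hr, mul_zero]
  · simpa only [variance_const_mul, (hξ _).variance_eq] using hb.mul_right _

theorem tendsto_prod_exp_gammaExponent (hr : 0 < r)
    (hξ : ∀ j, HasLaw (ξ j) (centeredGamma r) P) (hind : iIndepFun ξ P)
    (hY : ∀ᵐ ω ∂P, Tendsto (fun K => ∑ j ∈ Finset.range K, b j * ξ j ω) atTop (𝓝 (Y ω)))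
    (t : ℝ) :
    Tendsto (fun K => ∏ j ∈ Finset.range K, cexp (gammaExponent r (b j * (t * I)))) atTop
      (𝓝 (charFun (P.map Y) t)) := by
  simp_rw [← charFun_sum_mul hr hξ hind]
  exact tendsto_charFun_map_of_ae_tendsto (fun K =>
    Finset.aemeasurable_fun_sum _ fun j _ => (hξ j).aemeasurable.const_mul _) hY t

theorem exists_hasSum_seriesCoeff_and_charFun_eq (hr : 0 < r)
    (hξ : ∀ j, HasLaw (ξ j) (centeredGamma r) P) (hind : iIndepFun ξ P)
    (hb : Summable fun j => b j ^ 2)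
    (hY : ∀ᵐ ω ∂P, Tendsto (fun K => ∑ j ∈ Finset.range K, b j * ξ j ω) atTop (𝓝 (Y ω)))
    {t : ℝ} (ht : ∀ j, |b j * t| ≤ r / 2) :
    ∃ s, HasSum (fun m => (seriesCoeff r b m : ℂ) * (t * I) ^ m) s ∧
      charFun (P.map Y) t = cexp s := by
  obtain ⟨s, hs, hcoeff⟩ := exists_hasSum_seriesCoeff hr hb (z := t * I) (by simpa using ht)
  refine ⟨s, hcoeff,
    tendsto_nhds_unique (tendsto_prod_exp_gammaExponent hr hξ hind hY t) ?_⟩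
  simp_rw [← Complex.exp_sum]
  exact (Complex.continuous_exp.tendsto _).comp hs.tendsto_sum_nat

theorem cumulant_eq_factorial_mul_seriesCoeff (hr : 0 < r)
    (hξ : ∀ j, HasLaw (ξ j) (centeredGamma r) P) (hind : iIndepFun ξ P)
    (hb : Summable fun j => b j ^ 2)
    (hY : ∀ᵐ ω ∂P, Tendsto (fun K => ∑ j ∈ Finset.range K, b j * ξ j ω) atTop (𝓝 (Y ω)))
    (k : ℕ) : cumulant P Y k = k.factorial * seriesCoeff r b k :=
  cumulant_eq_of_charFun (aemeasurable_of_ae_tendsto_sum_mul hξ hY)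
    (zero_mem_interior_integrableExpSet hr hξ hind hb hY)
    ((eventually_forall_abs_mul_le hb (half_pos hr)).mono fun _ ht =>
      exists_hasSum_seriesCoeff_and_charFun_eq hr hξ hind hb hY ht) k

theorem variance_of_ae_tendsto_sum_mul (hr : 0 < r)
    (hξ : ∀ j, HasLaw (ξ j) (centeredGamma r) P) (hind : iIndepFun ξ P)
    (hb : Summable fun j => b j ^ 2)
    (hY : ∀ᵐ ω ∂P, Tendsto (fun K => ∑ j ∈ Finset.range K, b j * ξ j ω) atTop (𝓝 (Y ω))) :
    variance Y P = 1 / r * ∑' j, b j ^ 2 := by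
  rw [← cumulant_two (zero_mem_interior_integrableExpSet hr hξ hind hb hY),
    cumulant_eq_factorial_mul_seriesCoeff hr hξ hind hb hY, seriesCoeff, gammaCoeff]
  norm_num
  ring

end GammaSeries

/-! ### Edgeworth expansion of normalized gamma series -/

section NormalizedSeries

variable {r θ : ℝ} {b : ℕ → ℝ}

theorem integrable_abs_pow_mul_inv_one_add_sq_div_pow {n m : ℕ} (hnm : n < m) {c : ℝ}
    (hc : 0 < c) : Integrable fun t : ℝ => |t| ^ n * ((1 + t ^ 2 / c) ^ m)⁻¹ := by
  have hscale (t : ℝ) : min c⁻¹ 1 * (1 + t ^ 2) ≤ 1 + t ^ 2 / c := by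
    have := mul_le_mul_of_nonneg_right (min_le_left c⁻¹ 1) (sq_nonneg t)
    rw [div_eq_inv_mul]
    linarith [min_le_right c⁻¹ 1]
  have habs (t : ℝ) : |t| ≤ 1 + t ^ 2 := by nlinarith [sq_abs t, sq_nonneg (|t| - 1)]
  refine (integrable_inv_one_add_sq.const_mul (min c⁻¹ 1 ^ m)⁻¹).mono'
    (Continuous.aestronglyMeasurable ?_) (ae_of_all _ fun t => ?_)
  · exact (by fun_prop : Continuous fun t : ℝ => |t| ^ n).mul
      (Continuous.inv₀ (by fun_prop) fun t => by positivity)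
  · rw [Real.norm_of_nonneg (by positivity)]
    have : 0 < min c⁻¹ 1 := lt_min (inv_pos.mpr hc) one_pos
    calc |t| ^ n * ((1 + t ^ 2 / c) ^ m)⁻¹
        ≤ (1 + t ^ 2) ^ (m - 1) * ((min c⁻¹ 1 * (1 + t ^ 2)) ^ m)⁻¹ := by
          gcongr
          · exact (pow_le_pow_left₀ (abs_nonneg t) (habs t) n).trans
              (pow_le_pow_right₀ (by nlinarith [sq_nonneg t]) (by omega))
          · exact hscale t
      _ = (min c⁻¹ 1 ^ m)⁻¹ * (1 + t ^ 2)⁻¹ := by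
          obtain ⟨k, rfl⟩ := Nat.exists_eq_add_of_lt hnm
          have : 0 < 1 + t ^ 2 := by positivity
          rw [mul_pow, pow_succ (1 + t ^ 2), Nat.add_sub_cancel]
          field_simp

theorem abs_seriesCoeff_le (hr : 0 < r) (hb : ∀ j, |b j| ≤ r * θ)
    (hb2 : HasSum (fun j => b j ^ 2) r) {m : ℕ} (hm : 2 ≤ m) :
    |seriesCoeff r b m| ≤ θ ^ (m - 2) := by
  obtain ⟨n, rfl⟩ := Nat.exists_eq_add_of_le hm
  have hpow (j : ℕ) : ‖b j ^ (2 + n)‖ ≤ b j ^ 2 * (r * θ) ^ n := by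
    rw [norm_pow, Real.norm_eq_abs, pow_add, sq_abs]
    gcongr
    exact hb j
  have hsum : |∑' j, b j ^ (2 + n)| ≤ r * (r * θ) ^ n :=
    tsum_of_norm_bounded (hb2.mul_right _) hpow
  have hcast : 1 ≤ ((2 + n : ℕ) : ℝ) := by exact_mod_cast (by omega : 1 ≤ 2 + n)
  rw [seriesCoeff, abs_mul, abs_of_nonneg (gammaCoeff_nonneg hr _), gammaCoeff,
    if_neg (by omega), show 2 + n - 1 = n + 1 by omega, Nat.add_sub_cancel_left]
  calc (r ^ (n + 1) * ((2 + n : ℕ) : ℝ))⁻¹ * |∑' j, b j ^ (2 + n)|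
      ≤ (r ^ (n + 1) * 1)⁻¹ * (r * (r * θ) ^ n) := by gcongr
    _ = θ ^ n := by
      rw [mul_one, mul_pow, pow_succ]
      field_simp

-- Bernoulli's inequality, `(1 + x) ^ w ≤ 1 + w * x` for `w ≤ 1`, with `w = b ^ 2 / (r * θ) ^ 2`.
theorem norm_exp_gammaExponent_mul_I_le (hr : 0 < r) (hθ : 0 < θ) {b : ℝ} (hb : |b| ≤ r * θ)
    (t : ℝ) : ‖cexp (gammaExponent r (b * (t * I)))‖ ≤
      (1 + θ ^ 2 * t ^ 2) ^ (-(b ^ 2 / (2 * r * θ ^ 2))) := by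
  have hx : 0 ≤ θ ^ 2 * t ^ 2 := by positivity
  have hw : b ^ 2 / (r * θ) ^ 2 ≤ 1 := by
    rw [div_le_one (by positivity), sq_le_sq, abs_of_pos (mul_pos hr hθ)]
    exact hb
  have hbernoulli := rpow_one_add_le_one_add_mul_self (by linarith) (by positivity) hw
    (s := θ ^ 2 * t ^ 2)
  have hbase : 1 + b ^ 2 / (r * θ) ^ 2 * (θ ^ 2 * t ^ 2) = 1 + (b * t) ^ 2 / r ^ 2 := by
    field_simp
  have hexponent : -(b ^ 2 / (2 * r * θ ^ 2)) = b ^ 2 / (r * θ) ^ 2 * -(r / 2) := by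
    field_simp
  rw [← mul_assoc, ← ofReal_mul, norm_exp_gammaExponent_mul_I, hexponent,
    Real.rpow_mul (by positivity), ← hbase]
  exact Real.rpow_le_rpow_of_nonpos (by positivity) hbernoulli (by linarith)

variable {Ω : Type*} [MeasurableSpace Ω] {P : Measure Ω} [IsProbabilityMeasure P]
  {ξ : ℕ → Ω → ℝ} {Y : Ω → ℝ}

theorem norm_charFun_le_rpow (hr : 0 < r) (hθ : 0 < θ)
    (hξ : ∀ j, HasLaw (ξ j) (centeredGamma r) P) (hind : iIndepFun ξ P)
    (hb : ∀ j, |b j| ≤ r * θ) (hb2 : HasSum (fun j => b j ^ 2) r)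
    (hY : ∀ᵐ ω ∂P, Tendsto (fun K => ∑ j ∈ Finset.range K, b j * ξ j ω) atTop (𝓝 (Y ω)))
    (t : ℝ) : ‖charFun (P.map Y) t‖ ≤ (1 + θ ^ 2 * t ^ 2) ^ (-(1 / (2 * θ ^ 2))) := by
  have hpos : 0 < 1 + θ ^ 2 * t ^ 2 := by positivity
  have hexponent : Tendsto (fun K => ∑ j ∈ Finset.range K, -(b j ^ 2 / (2 * r * θ ^ 2))) atTop
      (𝓝 (-(1 / (2 * θ ^ 2)))) := by
    have hlim : -(r / (2 * r * θ ^ 2)) = -(1 / (2 * θ ^ 2)) := by field_simp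
    exact hlim ▸ (hb2.div_const _).neg.tendsto_sum_nat
  refine le_of_tendsto_of_tendsto' (tendsto_prod_exp_gammaExponent hr hξ hind hY t).norm
    (tendsto_const_nhds.rpow hexponent (Or.inl hpos.ne')) fun K => ?_
  rw [norm_prod, Real.rpow_sum_of_pos hpos]
  exact Finset.prod_le_prod (fun j _ => norm_nonneg _) fun j _ =>
    norm_exp_gammaExponent_mul_I_le hr hθ (hb j) t

-- Again Bernoulli's inequality, now `1 + n * x ≤ (1 + x) ^ n` with a real exponent `n ≥ 1`.
theorem rpow_neg_le_inv_pow {n : ℕ} (hn : 0 < n) (hθ : 0 < θ) (hnθ : 2 * n * θ ^ 2 ≤ 1) (t : ℝ) :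
    (1 + θ ^ 2 * t ^ 2) ^ (-(1 / (2 * θ ^ 2))) ≤ ((1 + t ^ 2 / (2 * n)) ^ n)⁻¹ := by
  have : (0 : ℝ) < n := by exact_mod_cast hn
  have hpos : 0 < 1 + θ ^ 2 * t ^ 2 := by positivity
  have hbernoulli : 1 + t ^ 2 / (2 * n) ≤ (1 + θ ^ 2 * t ^ 2) ^ (1 / (2 * n * θ ^ 2)) := by
    have h := one_add_mul_self_le_rpow_one_add (s := θ ^ 2 * t ^ 2) (by linarith)
      (p := 1 / (2 * n * θ ^ 2)) (by rwa [one_le_div (by positivity)])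
    have hlin : 1 / (2 * n * θ ^ 2) * (θ ^ 2 * t ^ 2) = t ^ 2 / (2 * n) := by field_simp
    rwa [hlin] at h
  have hexponent : 1 / (2 * θ ^ 2) = 1 / (2 * n * θ ^ 2) * n := by field_simp
  rw [Real.rpow_neg hpos.le, hexponent, Real.rpow_mul hpos.le, Real.rpow_natCast]
  gcongr

/-- The constant in the Edgeworth expansion of order `N` of a normalized gamma series. -/
noncomputable def edgeworthConst (N : ℕ) : ℝ :=
  Real.pi⁻¹ * ∫ t, edgeworthMajorant N
    (fun t => ((1 + t ^ 2 / (2 * (N + 1 : ℕ))) ^ (N + 1))⁻¹) t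

theorem abs_measureReal_sub_edgeworth_cumulant_le (hr : 0 < r) {N : ℕ} (hN : 2 ≤ N) (hθ : 0 < θ)
    (hθN : 2 * (N + 1 : ℕ) * θ ^ 2 ≤ 1)
    (hξ : ∀ j, HasLaw (ξ j) (centeredGamma r) P) (hind : iIndepFun ξ P)
    (hb : ∀ j, |b j| ≤ r * θ) (hb2 : HasSum (fun j => b j ^ 2) r)
    (hY : ∀ᵐ ω ∂P, Tendsto (fun K => ∑ j ∈ Finset.range K, b j * ξ j ω) atTop (𝓝 (Y ω)))
    (x : ℝ) :
    |P.real {ω | Y ω ≤ x} - edgeworth N (cumulant P Y) x| ≤ edgeworthConst N * θ ^ (N - 1) := by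
  have hYm := aemeasurable_of_ae_tendsto_sum_mul hξ hY
  have hθ1 : θ ≤ 1 := by
    refine (sq_le_one_iff₀ hθ.le).mp (le_trans ?_ hθN)
    push_cast
    nlinarith [sq_nonneg θ, (Nat.cast_nonneg N : (0 : ℝ) ≤ N)]
  have hκ := cumulant_eq_factorial_mul_seriesCoeff hr hξ hind hb2.summable hY
  have hcoeff (m : ℕ) : cumulant P Y m / m.factorial = seriesCoeff r b m := by
    rw [hκ, mul_div_cancel_left₀ _ (by positivity)]
  have hκ2 : cumulant P Y 2 = 1 := by
    rw [hκ, seriesCoeff, hb2.tsum_eq, gammaCoeff]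
    norm_num
    field_simp
  have hreal : P.real {ω | Y ω ≤ x} = (P.map Y).real (Set.Iic x) :=
    (map_measureReal_apply_of_aemeasurable hYm measurableSet_Iic).symm
  rw [hreal]
  refine abs_measureReal_Iic_sub_edgeworth_le hN (by simp [hκ, seriesCoeff, gammaCoeff])
    (by simp [hκ, seriesCoeff, gammaCoeff]) hκ2 hθ hθ1 (fun m hm => ?_) (fun t ht => ?_)
    (fun t => (norm_charFun_le_rpow hr hθ hξ hind hb hb2 hY t).trans
      (rpow_neg_le_inv_pow N.succ_pos hθ hθN t))
    (integrable_abs_pow_mul_inv_one_add_sq_div_pow (by omega) (by positivity)) x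
  · rw [hcoeff]
    exact abs_seriesCoeff_le hr hb hb2 (by omega)
  · simp_rw [hcoeff]
    refine exists_hasSum_seriesCoeff_and_charFun_eq hr hξ hind hb2.summable hY fun j => ?_
    rw [abs_mul]
    calc |b j| * |t| ≤ r * (θ * |t|) := by
          rw [← mul_assoc]
          gcongr
          exact hb j
      _ ≤ r / 2 := by nlinarith

end NormalizedSeries

/-! ### Tails of the gamma series -/

section Tail

variable {Ω : Type*} {lam : ℕ → ℝ} {η : ℕ → Ω → ℝ}

theorem tendsto_partialTail_iff (M : ℕ) (ω : Ω) (l : ℝ) :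
    Tendsto (fun K => ∑ j ∈ Finset.range K, lam (M + j) * (η (M + j) ω - 1)) atTop (𝓝 l) ↔
      Tendsto (fun K => partialTail lam η M K ω) atTop (𝓝 l) := by
  rw [← tendsto_add_atTop_iff_nat M (f := fun K => partialTail lam η M K ω)]
  simp_rw [partialTail, Finset.sum_Ico_eq_sum_range, Nat.add_sub_cancel]

theorem summable_sq_shift (hsq : Summable fun n => lam n ^ 2) (M : ℕ) :
    Summable fun j => lam (M + j) ^ 2 :=
  hsq.comp_injective (add_right_injective M)

theorem tsum_sq_shift_pos (hsq : Summable fun n => lam n ^ 2) (hne : ∃ᶠ n in atTop, lam n ≠ 0)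
    (M : ℕ) : 0 < ∑' j, lam (M + j) ^ 2 := by
  obtain ⟨n, hMn, hn⟩ := frequently_atTop.mp hne M
  obtain ⟨j, rfl⟩ := Nat.exists_eq_add_of_le hMn
  exact (summable_sq_shift hsq M).tsum_pos (fun _ => sq_nonneg _) j (by positivity)

variable [MeasurableSpace Ω] {P : Measure Ω} {r : ℝ} {M : ℕ}

theorem hasLaw_sub_one (hlaw : ∀ n : ℕ, 1 ≤ n → HasLaw (η n) (gammaMeasure r r) P) (hM : 1 ≤ M)
    (j : ℕ) : HasLaw (fun ω => η (M + j) ω - 1) (centeredGamma r) P := by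
  have hshift : HasLaw (fun x : ℝ => x - 1) (centeredGamma r) (gammaMeasure r r) :=
    ⟨by fun_prop, rfl⟩
  exact hshift.comp (hlaw (M + j) (by omega))

theorem iIndepFun_sub_one (hindep : iIndepFun (fun n : ℕ => η (n + 1)) P) (hM : 1 ≤ M) :
    iIndepFun (fun j ω => η (M + j) ω - 1) P := by
  have hshift := hindep.precomp (add_right_injective (M - 1))
  have hindex (j : ℕ) : M - 1 + j + 1 = M + j := by omega
  simp only [hindex] at hshift
  exact hshift.comp (fun _ x => x - 1) fun _ => by fun_prop

variable [IsProbabilityMeasure P]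

theorem ae_tendsto_partialTail (hr : 0 < r) (hsq : Summable fun n => lam n ^ 2)
    (hlaw : ∀ n : ℕ, 1 ≤ n → HasLaw (η n) (gammaMeasure r r) P)
    (hindep : iIndepFun (fun n : ℕ => η (n + 1)) P) (hM : 1 ≤ M) :
    ∀ᵐ ω ∂P, Tendsto (fun K : ℕ => partialTail lam η M K ω) atTop (𝓝 (tail lam η M ω)) := by
  filter_upwards [ae_exists_tendsto_sum_mul hr (hasLaw_sub_one hlaw hM)
    (iIndepFun_sub_one hindep hM) (summable_sq_shift hsq M)] with ω ⟨l, hl⟩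
  exact tendsto_nhds_limUnder ⟨l, (tendsto_partialTail_iff M ω l).mp hl⟩

theorem tailStd_sq (hr : 0 < r) (hsq : Summable fun n => lam n ^ 2)
    (hlaw : ∀ n : ℕ, 1 ≤ n → HasLaw (η n) (gammaMeasure r r) P)
    (hindep : iIndepFun (fun n : ℕ => η (n + 1)) P) (hM : 1 ≤ M) :
    tailStd P lam η M ^ 2 = 1 / r * ∑' j, lam (M + j) ^ 2 := by
  rw [tailStd, Real.sq_sqrt (variance_nonneg _ _)]
  refine variance_of_ae_tendsto_sum_mul hr (hasLaw_sub_one hlaw hM) (iIndepFun_sub_one hindep hM)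
    (summable_sq_shift hsq M) ?_
  filter_upwards [ae_tendsto_partialTail hr hsq hlaw hindep hM] with ω hω
  exact (tendsto_partialTail_iff M ω _).mpr hω

theorem ae_tendsto_normTail (hr : 0 < r) (hsq : Summable fun n => lam n ^ 2)
    (hlaw : ∀ n : ℕ, 1 ≤ n → HasLaw (η n) (gammaMeasure r r) P)
    (hindep : iIndepFun (fun n : ℕ => η (n + 1)) P) (hM : 1 ≤ M) :
    ∀ᵐ ω ∂P, Tendsto (fun K : ℕ => ∑ j ∈ Finset.range K,
      (tailStd P lam η M)⁻¹ * lam (M + j) * (η (M + j) ω - 1)) atTop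
        (𝓝 (normTail P lam η M ω)) := by
  filter_upwards [ae_tendsto_partialTail hr hsq hlaw hindep hM] with ω hω
  simpa only [Finset.mul_sum, ← mul_assoc, normTail] using
    ((tendsto_partialTail_iff M ω _).mpr hω).const_mul (tailStd P lam η M)⁻¹

theorem hasSum_cumulant_normTail (hr : 0 < r) (hsq : Summable fun n => lam n ^ 2)
    (hlaw : ∀ n : ℕ, 1 ≤ n → HasLaw (η n) (gammaMeasure r r) P)
    (hindep : iIndepFun (fun n : ℕ => η (n + 1)) P) (hM : 1 ≤ M) {k : ℕ} (hk : 2 ≤ k) :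
    HasSum (fun j : ℕ => ((k - 1).factorial : ℝ) /
        (r ^ (k - 1) * tailStd P lam η M ^ k) * lam (M + j) ^ k)
      (cumulant P (normTail P lam η M) k) := by
  have hb : Summable fun j => ((tailStd P lam η M)⁻¹ * lam (M + j)) ^ 2 := by
    simpa only [mul_pow] using (summable_sq_shift hsq M).mul_left _
  have hκ := cumulant_eq_factorial_mul_seriesCoeff hr (hasLaw_sub_one hlaw hM)
    (iIndepFun_sub_one hindep hM) hb (ae_tendsto_normTail hr hsq hlaw hindep hM) k
  have hcoeff : ((k - 1).factorial : ℝ) / (r ^ (k - 1) * tailStd P lam η M ^ k) =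
      k.factorial * gammaCoeff r k * (tailStd P lam η M)⁻¹ ^ k := by
    have hk0 : (k : ℝ) ≠ 0 := by positivity
    rw [gammaCoeff, if_neg (by omega), ← Nat.mul_factorial_pred (by omega : k ≠ 0)]
    push_cast
    rw [inv_pow]
    field_simp
  simp_rw [seriesCoeff, mul_pow] at hκ
  rw [hκ, tsum_mul_left, ← mul_assoc, ← mul_assoc, ← hcoeff]
  exact (summable_pow_of_summable_sq (summable_sq_shift hsq M) hk).hasSum.mul_left _

theorem abs_measureReal_normTail_sub_edgeworth_le (hr : 0 < r) (hsq : Summable fun n => lam n ^ 2)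
    (hne : ∃ᶠ n in atTop, lam n ≠ 0)
    (hlaw : ∀ n : ℕ, 1 ≤ n → HasLaw (η n) (gammaMeasure r r) P)
    (hindep : iIndepFun (fun n : ℕ => η (n + 1)) P) (hM : 1 ≤ M) {N : ℕ} (hN : 2 ≤ N) {θ : ℝ}
    (hθ : 0 < θ) (hθN : 2 * (N + 1 : ℕ) * θ ^ 2 ≤ 1)
    (hlam : ∀ j, lam (M + j) ^ 2 ≤ r * θ ^ 2 * ∑' i, lam (M + i) ^ 2) (x : ℝ) :
    |P.real {ω | normTail P lam η M ω ≤ x} -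
        edgeworth N (cumulant P (normTail P lam η M)) x| ≤ edgeworthConst N * θ ^ (N - 1) := by
  have hσ : (tailStd P lam η M)⁻¹ ^ 2 * ∑' j, lam (M + j) ^ 2 = r := by
    have := tsum_sq_shift_pos hsq hne M
    rw [inv_pow, tailStd_sq hr hsq hlaw hindep hM]
    field_simp
  refine abs_measureReal_sub_edgeworth_cumulant_le hr hN hθ hθN (hasLaw_sub_one hlaw hM)
    (iIndepFun_sub_one hindep hM) (fun j => ?_) ?_ (ae_tendsto_normTail hr hsq hlaw hindep hM) x
  · refine abs_le_of_sq_le_sq ?_ (by positivity)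
    calc ((tailStd P lam η M)⁻¹ * lam (M + j)) ^ 2
        ≤ (tailStd P lam η M)⁻¹ ^ 2 * (r * θ ^ 2 * ∑' i, lam (M + i) ^ 2) := by
          rw [mul_pow]
          gcongr
          exact hlam j
      _ = r * θ ^ 2 * ((tailStd P lam η M)⁻¹ ^ 2 * ∑' i, lam (M + i) ^ 2) := by ring
      _ = (r * θ) ^ 2 := by
          rw [hσ]
          ring
  · rw [← hσ]
    simpa only [mul_pow] using (summable_sq_shift hsq M).hasSum.mul_left _

theorem exists_eventually_abs_measureReal_normTail_sub_edgeworth_le (hr : 0 < r)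
    (hsq : Summable fun n => lam n ^ 2) (hne : ∃ᶠ n in atTop, lam n ≠ 0) {C : ℝ}
    (hC : ∀ᶠ M : ℕ in atTop, ∀ j, M * lam (M + j) ^ 2 ≤ C * ∑' i, lam (M + i) ^ 2)
    (hlaw : ∀ n : ℕ, 1 ≤ n → HasLaw (η n) (gammaMeasure r r) P)
    (hindep : iIndepFun (fun n : ℕ => η (n + 1)) P) {N : ℕ} (hN : 2 ≤ N) :
    ∃ D : ℝ, ∀ᶠ M : ℕ in atTop, ∀ x : ℝ,
      |P.real {ω | normTail P lam η M ω ≤ x} -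
          edgeworth N (cumulant P (normTail P lam η M)) x|
        ≤ D * (M : ℝ) ^ (-(((N : ℝ) - 1) / 2)) := by
  set A := max C 1 / r with hA
  have hA0 : 0 < A := div_pos (lt_max_of_lt_right one_pos) hr
  refine ⟨edgeworthConst N * Real.sqrt A ^ (N - 1), ?_⟩
  filter_upwards [hC, eventually_ge_atTop 1,
    tendsto_natCast_atTop_atTop.eventually_ge_atTop (2 * (N + 1 : ℕ) * A)] with M hM hM1 hMN x
  have hM0 : (0 : ℝ) < M := by exact_mod_cast hM1
  have hθ2 : (Real.sqrt A * (M : ℝ) ^ (-(1 / 2) : ℝ)) ^ 2 = A / M := by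
    rw [mul_pow, Real.sq_sqrt hA0.le, ← Real.rpow_mul_natCast hM0.le]
    norm_num [Real.rpow_neg_one, div_eq_mul_inv]
  have hrate : ((M : ℝ) ^ (-(1 / 2) : ℝ)) ^ (N - 1) = (M : ℝ) ^ (-(((N : ℝ) - 1) / 2)) := by
    rw [← Real.rpow_mul_natCast hM0.le, Nat.cast_pred (by omega)]
    ring_nf
  rw [mul_assoc, ← hrate, ← mul_pow]
  refine abs_measureReal_normTail_sub_edgeworth_le hr hsq hne hlaw hindep hM1 hN
    (by positivity) ?_ (fun j => ?_) x
  · rw [hθ2, ← mul_div_assoc]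
    exact div_le_one_of_le₀ hMN hM0.le
  · have hmax : C * ∑' i, lam (M + i) ^ 2 ≤ max C 1 * ∑' i, lam (M + i) ^ 2 :=
      mul_le_mul_of_nonneg_right (le_max_left _ _) (tsum_nonneg fun _ => sq_nonneg _)
    have hrA : r * (A / M) = max C 1 / M := by
      rw [hA]
      field_simp
    rw [hθ2, hrA, div_mul_eq_mul_div, le_div_iff₀ hM0, mul_comm]
    exact (hM j).trans hmax

end Tail

/-! ### Regularly varying coefficients -/

section RegularVariation

variable {γ : ℝ} {ℓ : ℝ → ℝ} {lam : ℕ → ℝ}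

theorem tendsto_two_mul_div (hℓ : SlowlyVarying ℓ)
    (hlam : ∀ n : ℕ, 1 ≤ n → lam n = ℓ n * (n : ℝ) ^ (-γ)) :
    Tendsto (fun n : ℕ => lam (2 * n) / lam n) atTop (𝓝 (2 ^ (-γ))) := by
  have hratio := ((hℓ.2 2 two_pos).comp tendsto_natCast_atTop_atTop).mul_const ((2 : ℝ) ^ (-γ))
  rw [one_mul] at hratio
  refine hratio.congr' ?_
  filter_upwards [eventually_ge_atTop 1] with n hn
  have hn0 : (0 : ℝ) < n := by exact_mod_cast hn
  rw [hlam n hn, hlam (2 * n) (by omega), Nat.cast_mul, Nat.cast_ofNat, Function.comp_apply,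
    Real.mul_rpow two_pos.le hn0.le, ← mul_assoc, mul_div_mul_right _ _ (by positivity),
    mul_div_right_comm]

theorem sq_le_sq_of_le (hpos : ∀ n : ℕ, 1 ≤ n → 0 < lam n) (hanti : AntitoneOn lam (Set.Ici 1))
    {m n : ℕ} (hm : 1 ≤ m) (hmn : m ≤ n) : lam n ^ 2 ≤ lam m ^ 2 :=
  pow_le_pow_left₀ (hpos n (hm.trans hmn)).le
    (hanti (Set.mem_Ici.mpr hm) (Set.mem_Ici.mpr (hm.trans hmn)) hmn) 2

theorem summable_sq_of_tendsto_two_mul_div (hγ : 1 / 2 < γ) (hpos : ∀ n : ℕ, 1 ≤ n → 0 < lam n)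
    (hanti : AntitoneOn lam (Set.Ici 1))
    (hratio : Tendsto (fun n : ℕ => lam (2 * n) / lam n) atTop (𝓝 (2 ^ (-γ)))) :
    Summable fun n => lam n ^ 2 := by
  have hlt : 2 * ((2 : ℝ) ^ (-γ)) ^ 2 < 1 := by
    rw [← Real.rpow_mul_natCast two_pos.le,
      ← Real.rpow_one_add' two_pos.le (by push_cast; linarith)]
    exact Real.rpow_lt_one_of_one_lt_of_neg one_lt_two (by push_cast; linarith)
  have hpow (k : ℕ) : 0 < lam (2 ^ k) := hpos _ Nat.one_le_two_pow
  rw [← summable_condensed_iff_of_nonneg (fun n => sq_nonneg (lam n))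
    fun m n hm hmn => sq_le_sq_of_le hpos hanti hm hmn]
  refine summable_of_ratio_test_tendsto_lt_one hlt
    (Eventually.of_forall fun k => (mul_pos (by positivity) (pow_pos (hpow k) 2)).ne') ?_
  refine (((hratio.comp (tendsto_pow_atTop_atTop_of_one_lt one_lt_two)).pow 2).const_mul 2).congr
    fun k => ?_
  have := hpow k
  have := hpow (k + 1)
  rw [Real.norm_of_nonneg (by positivity), Real.norm_of_nonneg (by positivity),
    Function.comp_apply, ← pow_succ', pow_succ' (2 : ℝ) k]
  field_simp

theorem exists_eventually_mul_sq_le_tsum (hpos : ∀ n : ℕ, 1 ≤ n → 0 < lam n)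
    (hanti : AntitoneOn lam (Set.Ici 1)) (hsq : Summable fun n => lam n ^ 2)
    {p : ℝ} (hp : 0 < p) (hratio : Tendsto (fun n : ℕ => lam (2 * n) / lam n) atTop (𝓝 p)) :
    ∃ C, ∀ᶠ M : ℕ in atTop, ∀ j, M * lam (M + j) ^ 2 ≤ C * ∑' i, lam (M + i) ^ 2 := by
  refine ⟨((p / 2) ^ 2)⁻¹, ?_⟩
  filter_upwards [hratio.eventually_const_le (half_lt_self hp), eventually_ge_atTop 1]
    with M hM hM1 j
  have hdouble : p / 2 * lam M ≤ lam (2 * M) := (le_div_iff₀ (hpos M hM1)).mp hM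
  rw [le_inv_mul_iff₀ (by positivity)]
  calc (p / 2) ^ 2 * (M * lam (M + j) ^ 2)
      ≤ (p / 2) ^ 2 * (M * lam M ^ 2) := by
        have := sq_le_sq_of_le hpos hanti hM1 (M.le_add_right j)
        gcongr ?_ * (?_ * ?_)
    _ = ∑ i ∈ Finset.range M, (p / 2 * lam M) ^ 2 := by
        rw [Finset.sum_const, Finset.card_range, nsmul_eq_mul]
        ring
    _ ≤ ∑ i ∈ Finset.range M, lam (M + i) ^ 2 := by
        refine Finset.sum_le_sum fun i hi => ?_
        refine (pow_le_pow_left₀ (mul_pos (half_pos hp) (hpos M hM1)).le hdouble 2).trans ?_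
        exact sq_le_sq_of_le hpos hanti (hM1.trans (M.le_add_right i))
          (by linarith [Finset.mem_range.mp hi])
    _ ≤ ∑' i, lam (M + i) ^ 2 :=
        (summable_sq_shift hsq M).sum_le_tsum _ fun _ _ => sq_nonneg _

end RegularVariation

end GammaTail

theorem theorem5p2_general {Ω : Type*} [MeasurableSpace Ω] (P : Measure Ω) [IsProbabilityMeasure P]
    (r : ℝ) (hr : 0 < r) (lam : ℕ → ℝ) (hsq : Summable fun n => lam n ^ 2)
    (hne : ∃ᶠ n in atTop, lam n ≠ 0)
    (hlam : ∃ C, ∀ᶠ M : ℕ in atTop, ∀ j, M * lam (M + j) ^ 2 ≤ C * ∑' i, lam (M + i) ^ 2)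
    (η : ℕ → Ω → ℝ) (hlaw : ∀ n : ℕ, 1 ≤ n → HasLaw (η n) (gammaMeasure r r) P)
    (hindep : iIndepFun (fun n : ℕ => η (n + 1)) P) :
    (∀ M : ℕ, 1 ≤ M → ∀ᵐ ω ∂P,
      Tendsto (fun K : ℕ => GammaTail.partialTail lam η M K ω) atTop
        (𝓝 (GammaTail.tail lam η M ω))) ∧
    (∀ M : ℕ, 1 ≤ M →
      HasSum (fun j : ℕ => 1 / r * lam (M + j) ^ 2) (GammaTail.tailStd P lam η M ^ 2)) ∧
    (∀ M : ℕ, 1 ≤ M → ∀ k : ℕ, 2 ≤ k →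
      HasSum (fun j : ℕ => ((k - 1).factorial : ℝ) /
          (r ^ (k - 1) * GammaTail.tailStd P lam η M ^ k) * lam (M + j) ^ k)
        (GammaTail.cumulant P (GammaTail.normTail P lam η M) k)) ∧
    (∀ N : ℕ, 2 ≤ N → ∃ C : ℝ, ∀ᶠ M : ℕ in atTop, ∀ x : ℝ,
      |P.real {ω | GammaTail.normTail P lam η M ω ≤ x} -
          GammaTail.edgeworth N (GammaTail.cumulant P (GammaTail.normTail P lam η M)) x|
        ≤ C * (M : ℝ) ^ (-(((N : ℝ) - 1) / 2))) := by
  obtain ⟨C, hC⟩ := hlam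
  refine ⟨fun M hM => GammaTail.ae_tendsto_partialTail hr hsq hlaw hindep hM, fun M hM => ?_,
    fun M hM k hk => GammaTail.hasSum_cumulant_normTail hr hsq hlaw hindep hM hk,
    fun N hN => GammaTail.exists_eventually_abs_measureReal_normTail_sub_edgeworth_le
      hr hsq hne hC hlaw hindep hN⟩
  rw [GammaTail.tailStd_sq hr hsq hlaw hindep hM]
  exact (GammaTail.summable_sq_shift hsq M).hasSum.mul_left (1 / r)

theorem theorem5p2 {Ω : Type*} [MeasurableSpace Ω] (P : Measure Ω) [IsProbabilityMeasure P]
    (r γ : ℝ) (hr : 0 < r) (hγ : 1 / 2 < γ)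
    (ℓ : ℝ → ℝ) (hℓ : GammaTail.SlowlyVarying ℓ)
    (lam : ℕ → ℝ) (hlam : ∀ n : ℕ, 1 ≤ n → lam n = ℓ n * (n : ℝ) ^ (-γ))
    (hpos : ∀ n : ℕ, 1 ≤ n → 0 < lam n) (hanti : AntitoneOn lam (Set.Ici 1))
    (η : ℕ → Ω → ℝ) (hlaw : ∀ n : ℕ, 1 ≤ n → HasLaw (η n) (gammaMeasure r r) P)
    (hindep : iIndepFun (fun n : ℕ => η (n + 1)) P) :
    -- the series defining the tail converges almost surely
    (∀ M : ℕ, 1 ≤ M → ∀ᵐ ω ∂P,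
      Tendsto (fun K : ℕ => GammaTail.partialTail lam η M K ω) atTop
        (𝓝 (GammaTail.tail lam η M ω))) ∧
    -- the variance of the tail
    (∀ M : ℕ, 1 ≤ M →
      HasSum (fun j : ℕ => 1 / r * lam (M + j) ^ 2) (GammaTail.tailStd P lam η M ^ 2)) ∧
    -- the cumulants of the normalized tail
    (∀ M : ℕ, 1 ≤ M → ∀ k : ℕ, 2 ≤ k →
      HasSum (fun j : ℕ => ((k - 1).factorial : ℝ) /
          (r ^ (k - 1) * GammaTail.tailStd P lam η M ^ k) * lam (M + j) ^ k)
        (GammaTail.cumulant P (GammaTail.normTail P lam η M) k)) ∧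
    -- the Edgeworth expansion, uniformly in `x`
    (∀ N : ℕ, 2 ≤ N → ∃ C : ℝ, ∀ᶠ M : ℕ in atTop, ∀ x : ℝ,
      |P.real {ω | GammaTail.normTail P lam η M ω ≤ x} -
          GammaTail.edgeworth N (GammaTail.cumulant P (GammaTail.normTail P lam η M)) x|
        ≤ C * (M : ℝ) ^ (-(((N : ℝ) - 1) / 2))) := by
  have hratio := GammaTail.tendsto_two_mul_div hℓ hlam
  have hsq := GammaTail.summable_sq_of_tendsto_two_mul_div hγ hpos hanti hratio
  exact theorem5p2_general P r hr lam hsq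
    ((eventually_ge_atTop 1).mono fun n hn => (hpos n hn).ne').frequently
    (GammaTail.exists_eventually_mul_sq_le_tsum hpos hanti hsq (by positivity) hratio)
    η hlaw hindep
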